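/- Let $n>2$ and $m>0$ be integers, let $(x)_m=x(x+1)\cdots(x+m-1)$ denote the Pochhammer symbol, and put $$S_m(t)=\frac{(n-1)_m}{(\frac n2)_m}\;{}_2F_1\!\left(m,\,1-\tfrac n2;\,m+\tfrac n2;\,t\right),\qquad 0\le t<1,$$ $$I_m(s)=\frac{\Gamma(\frac n2+s+1)}{\Gamma(\frac n2)\,\Gamma(s+1)}\int_0^1 t^{m+\frac n2-1}(1-t)^s\,S_m(t)^2\,dt,\qquad \operatorname{Re}s>-1,$$ where the integral converges absolutely. Then $I_m$ extends to a meromorphic function of $s$ on the whole complex plane, and this extension has a simple pole at $s=-n$, with residue $$\frac{(n-1)_m}{\Gamma(m)}\ \text{ if } n \text{ is even},\qquad \frac{2\,(n-1)_m}{\Gamma(m)}\ \text{ if } n \text{ is odd}.$$ -/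

import Mathlib

open Filter Topology MeasureTheory

/-- The radial factor
`S_m(t) = (n-1)_m / (n/2)_m * ₂F₁(m, 1 - n/2; m + n/2; t)` of the solid `H`-harmonics of degree `m`
on the unit ball of `ℝⁿ`, where `(x)_m = x (x+1) ⋯ (x+m-1)`. -/
noncomputable def radialFactor (n m : ℕ) (t : ℝ) : ℝ :=
  (ascPochhammer ℝ m).eval ((n : ℝ) - 1) / (ascPochhammer ℝ m).eval ((n : ℝ) / 2) *
    ordinaryHypergeometric (m : ℝ) (1 - (n : ℝ) / 2) ((m : ℝ) + (n : ℝ) / 2) t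

/-- The integrand `t^(m+n/2-1) (1-t)^s S_m(t)²` at a complex parameter `s`. -/
noncomputable def coeffIntegrand (n m : ℕ) (s : ℂ) (t : ℝ) : ℂ :=
  ((t ^ ((m : ℝ) + (n : ℝ) / 2 - 1) : ℝ) : ℂ) * ((1 - t : ℝ) : ℂ) ^ s *
    ((radialFactor n m t : ℝ) : ℂ) ^ 2

/-- The coefficient function
`I_m(s) = Γ(n/2+s+1) / (Γ(n/2) Γ(s+1)) * ∫₀¹ t^(m+n/2-1) (1-t)^s S_m(t)² dt`,
meaningful for `Re s > -1`. -/
noncomputable def coeffI (n m : ℕ) (s : ℂ) : ℂ :=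
  Complex.Gamma ((n : ℂ) / 2 + s + 1) / (Complex.Gamma ((n : ℂ) / 2) * Complex.Gamma (s + 1)) *
    ∫ t in (0 : ℝ)..1, coeffIntegrand n m s t

/-- `f` has a simple pole at `z` with residue `r`. -/
def HasSimplePoleWithResidue (f : ℂ → ℂ) (z r : ℂ) : Prop :=
  meromorphicOrderAt f z = -1 ∧ Tendsto (fun s => (s - z) * f s) (𝓝[≠] z) (𝓝 r)

/-! Write h = n/2 and K = (n-1)_m / Γ(m). Euler's integral gives S_m = K·J on [0,1) with J =
`eulerIntegral m h`, and a beta integral gives K·J(1) = 1. With x = 1 - t the integral becomes the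
Mellin transform at z = s + 1 of the weight W(x) = (1-x)^(m+h-1) (K·J(1-x))² on (0,1]. Its poles are
read off from the expansion of W at x = 0: a term c x^j gives c/(z+j), a term c x^j log x gives
-c/(z+j)². The point s = -n is z = -(n-1), so the power x^(n-1) decides.

Substituting w = tu turns (1-x)^(m+h-1) J(1-x) into the integral of w^(m-1) (1-x-w)^(h-1)
(1-w)^(h-1) over [0, 1-x].

Even n: everything is polynomial. Extending the range to [0,1] costs a piece (-1)^h x^(n-1) Q(x)
with Q(0) = B(h,h); the remaining factors have degree at most h-1 each and cannot reach x^(n-1).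
Hence W has coefficient K (-1)^h B(h,h) there (`exists_polynomial_radialWeight`), while the Gamma
factor tends to (1-n)_h / Γ(h). The product is K.

Odd n = 2k+1: the Gamma factor has a simple zero at s = -n, so the double pole of the Mellin
transform matters. The integral above is A + x^(2k) B log x with A, B analytic at 0, K·A(0) = 1 and
B(0) = `logCoeff k k` (`exists_eulerIntegral_expansion`). Squaring J doubles the cross term, which
gives x^(2k) log x the coefficient 2K·B(0) and hence the residue its extra factor 2; the log² term
starts at x^(4k) and stays out of reach. `exists_mellin_continuation` converts such an expansion
into a meromorphic function. -/

/-! ### Euler's integral and the radial factor -/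

/-- Euler's integral `∫₀¹ u^(m-1) (1-u)^(h-1) (1-tu)^(h-1) du`. -/
noncomputable def eulerIntegral (m : ℕ) (h t : ℝ) : ℝ :=
  ∫ u in (0 : ℝ)..1, u ^ (m - 1) * (1 - u) ^ (h - 1) * (1 - t * u) ^ (h - 1)

/-- All exponents are nonnegative when `1 ≤ h`, so continuity includes t = 1, where the
hypergeometric series is not used. This permits the limit x → 0 in the odd case. -/
theorem continuous_eulerIntegral (m : ℕ) {h : ℝ} (hh : 1 ≤ h) :
    Continuous (eulerIntegral m h) := by
  unfold eulerIntegral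
  have h0 : 0 ≤ h - 1 := by linarith
  refine intervalIntegral.continuous_parametric_intervalIntegral_of_continuous' ?_ 0 1
  have h1 : Continuous fun p : ℝ × ℝ => (1 - p.2) ^ (h - 1) :=
    (by fun_prop : Continuous fun p : ℝ × ℝ => 1 - p.2).rpow_const fun _ => Or.inr h0
  have h2 : Continuous fun p : ℝ × ℝ => (1 - p.1 * p.2) ^ (h - 1) :=
    (by fun_prop : Continuous fun p : ℝ × ℝ => 1 - p.1 * p.2).rpow_const fun _ => Or.inr h0
  exact ((by fun_prop : Continuous fun p : ℝ × ℝ => p.2 ^ (m - 1)).mul h1).mul h2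

theorem integral_rpow_mul_one_sub_rpow {a b : ℝ} (ha : 0 < a) (hb : 0 < b) :
    ∫ u in (0 : ℝ)..1, u ^ (a - 1) * (1 - u) ^ (b - 1) =
      Real.Gamma a * Real.Gamma b / Real.Gamma (a + b) := by
  have key := Complex.betaIntegral_eq_Gamma_mul_div (a : ℂ) (b : ℂ) (by simpa) (by simpa)
  rw [← Complex.ofReal_add, Complex.Gamma_ofReal, Complex.Gamma_ofReal, Complex.Gamma_ofReal,
    Complex.betaIntegral] at key
  apply Complex.ofReal_injective
  push_cast
  rw [← key, ← intervalIntegral.integral_ofReal]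
  refine intervalIntegral.integral_congr fun u hu => ?_
  rw [Set.uIcc_of_le zero_le_one] at hu
  rw [Complex.ofReal_mul, Complex.ofReal_cpow hu.1, Complex.ofReal_cpow (sub_nonneg.2 hu.2)]
  push_cast
  rfl

theorem integral_pow_mul_one_sub_rpow (k : ℕ) {b : ℝ} (hb : 0 < b) :
    ∫ u in (0 : ℝ)..1, u ^ k * (1 - u) ^ (b - 1) =
      Real.Gamma (k + 1) * Real.Gamma b / Real.Gamma (k + 1 + b) := by
  rw [← integral_rpow_mul_one_sub_rpow (by positivity) hb]
  simp

theorem Ring.multichoose_real_eq (a : ℝ) (k : ℕ) :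
    Ring.multichoose a k = ((k.factorial : ℝ))⁻¹ * (ascPochhammer ℝ k).eval a := by
  have h := Ring.factorial_nsmul_multichoose_eq_ascPochhammer a k
  rw [nsmul_eq_mul, Polynomial.ascPochhammer_smeval_eq_eval] at h
  rw [← h]
  field_simp

/-- The binomial series of `(1 - y) ^ (-a)`. -/
theorem hasSum_one_sub_rpow_neg (a : ℝ) {y : ℝ} (hy : |y| < 1) :
    HasSum (fun k : ℕ => ((k.factorial : ℝ))⁻¹ * (ascPochhammer ℝ k).eval a * y ^ k)
      ((1 - y) ^ (-a)) := by
  have h := (Real.one_div_one_sub_rpow_hasFPowerSeriesOnBall_zero a).hasSum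
    (y := y) (by simpa [enorm_eq_nnnorm, ← NNReal.coe_lt_coe] using hy)
  have h1 : 0 ≤ 1 - y := by linarith [(abs_lt.1 hy).2]
  simp only [zero_add, one_div] at h
  rw [Real.rpow_neg h1]
  rw [show (fun k : ℕ => ((k.factorial : ℝ))⁻¹ * (ascPochhammer ℝ k).eval a * y ^ k) = _ from
    funext fun k => ?_]
  · exact h
  · rw [FormalMultilinearSeries.ofScalars_apply_eq, ← Ring.multichoose_real_eq, smul_eq_mul,
      Ring.choose]
    congr 2
    ring

theorem summable_binomial_coeff_mul_pow (a : ℝ) {y : ℝ} (hy0 : 0 ≤ y) (hy : y < 1) :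
    Summable fun k : ℕ => |((k.factorial : ℝ))⁻¹ * (ascPochhammer ℝ k).eval a| * y ^ k := by
  have h := (hasSum_one_sub_rpow_neg a (y := y) (by rwa [abs_of_nonneg hy0])).summable.abs
  refine h.congr fun k => ?_
  rw [abs_mul, abs_of_nonneg (pow_nonneg hy0 k)]

theorem ascPochhammer_eval_eq_Gamma_div {x : ℝ} (hx : 0 < x) (k : ℕ) :
    (ascPochhammer ℝ k).eval x = Real.Gamma (x + k) / Real.Gamma x := by
  induction k with
  | zero => simp [(Real.Gamma_pos_of_pos hx).ne']
  | succ k ih =>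
    have : (0 : ℝ) < x + k := by positivity
    rw [ascPochhammer_succ_eval, ih, Nat.cast_succ, ← add_assoc, Real.Gamma_add_one this.ne']
    ring

/-- Euler's integral representation of the hypergeometric function. -/
theorem eulerIntegral_eq (m : ℕ) (hm : 0 < m) {h t : ℝ} (hh : 1 ≤ h) (ht0 : 0 ≤ t) (ht : t < 1) :
    eulerIntegral m h t = Real.Gamma m * Real.Gamma h / Real.Gamma (m + h) *
      ordinaryHypergeometric (m : ℝ) (1 - h) (m + h) t := by
  have hh0 : 0 < h := by linarith
  set c : ℕ → ℝ := fun k => ((k.factorial : ℝ))⁻¹ * (ascPochhammer ℝ k).eval (1 - h) with hc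
  have hw : Continuous fun u : ℝ => (1 - u) ^ (h - 1) :=
    (by fun_prop : Continuous fun u : ℝ => 1 - u).rpow_const fun _ => Or.inr (by linarith)
  have hbound : ∀ u ∈ Set.uIoc (0 : ℝ) 1, 0 ≤ u ∧ u ≤ 1 := fun u hu => by
    rw [Set.uIoc_of_le zero_le_one] at hu
    exact ⟨hu.1.le, hu.2⟩
  have hS : HasSum (fun k => ∫ u in (0 : ℝ)..1,
      u ^ (m - 1) * (1 - u) ^ (h - 1) * (c k * (t * u) ^ k)) (eulerIntegral m h t) := by
    refine intervalIntegral.hasSum_integral_of_dominated_convergence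
      (fun k _ => |c k| * t ^ k) (fun k => ?_) (fun k => ?_) ?_ ?_ ?_
    · refine Continuous.aestronglyMeasurable ?_
      fun_prop
    · refine ae_of_all _ fun u hu => ?_
      obtain ⟨hu0, hu1⟩ := hbound u hu
      have e1 : u ^ (m - 1) ≤ 1 := pow_le_one₀ hu0 hu1
      have e2 : (1 - u) ^ (h - 1) ≤ 1 :=
        Real.rpow_le_one (by linarith) (by linarith) (by linarith)
      have e3 : (0 : ℝ) ≤ (1 - u) ^ (h - 1) := Real.rpow_nonneg (by linarith) _
      have e4 : (t * u) ^ k ≤ t ^ k := by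
        gcongr
        nlinarith
      rw [Real.norm_eq_abs, abs_mul, abs_mul, abs_mul, abs_of_nonneg (pow_nonneg hu0 _),
        abs_of_nonneg e3, abs_of_nonneg (pow_nonneg (mul_nonneg ht0 hu0) _)]
      calc u ^ (m - 1) * (1 - u) ^ (h - 1) * (|c k| * (t * u) ^ k)
          ≤ 1 * (|c k| * t ^ k) := by
            gcongr
            exact mul_le_one₀ e1 e3 e2
        _ = _ := one_mul _
    · exact ae_of_all _ fun u _ => summable_binomial_coeff_mul_pow (1 - h) ht0 ht
    · simp
    · refine ae_of_all _ fun u hu => ?_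
      obtain ⟨hu0, hu1⟩ := hbound u hu
      have := hasSum_one_sub_rpow_neg (1 - h) (y := t * u)
        (by rw [abs_of_nonneg (by positivity)]; nlinarith)
      rw [neg_sub] at this
      exact this.mul_left _
  rw [← hS.tsum_eq, ordinaryHypergeometric_eq_tsum, ← tsum_mul_left]
  refine tsum_congr fun k => ?_
  have e : ∫ u in (0 : ℝ)..1, u ^ (m - 1) * (1 - u) ^ (h - 1) * (c k * (t * u) ^ k) =
      c k * t ^ k * ∫ u in (0 : ℝ)..1, u ^ (m - 1 + k) * (1 - u) ^ (h - 1) := by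
    rw [← intervalIntegral.integral_const_mul]
    congr 1 with u
    rw [mul_pow, pow_add]
    ring
  have hm' : (0 : ℝ) < m := by exact_mod_cast hm
  have hmk : ((m - 1 + k : ℕ) : ℝ) + 1 = m + k := by
    have : m - 1 + k + 1 = m + k := by omega
    exact_mod_cast this
  rw [e, integral_pow_mul_one_sub_rpow _ hh0, hmk, smul_eq_mul,
    ascPochhammer_eval_eq_Gamma_div hm', ascPochhammer_eval_eq_Gamma_div (x := m + h) (by positivity)]
  have g1 := (Real.Gamma_pos_of_pos hm').ne'
  have g2 := (Real.Gamma_pos_of_pos (by positivity : 0 < (m : ℝ) + h)).ne'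
  have g3 := (Real.Gamma_pos_of_pos (by positivity : 0 < (m : ℝ) + h + k)).ne'
  rw [show (m : ℝ) + k + h = m + h + k by ring]
  simp only [hc]
  field_simp

/-- At t = 1 the two factors with exponent h - 1 merge into one, leaving a beta integral. -/
theorem eulerIntegral_one (m : ℕ) (hm : 0 < m) {h : ℝ} (hh : 1 ≤ h) :
    eulerIntegral m h 1 = Real.Gamma m * Real.Gamma (2 * h - 1) / Real.Gamma (m + (2 * h - 1)) := by
  have e : ((m - 1 : ℕ) : ℝ) + 1 = m := by
    have : m - 1 + 1 = m := by omega
    exact_mod_cast this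
  have := integral_pow_mul_one_sub_rpow (m - 1) (b := 2 * h - 1) (by linarith)
  rw [e] at this
  rw [← this, eulerIntegral]
  refine intervalIntegral.integral_congr fun u hu => ?_
  rw [Set.uIcc_of_le zero_le_one] at hu
  simp only [one_mul]
  rw [mul_assoc, ← Real.rpow_add_of_nonneg (by linarith [hu.2]) (by linarith) (by linarith)]
  ring_nf

/-- The constant `(n-1)_m / Γ(m)`. -/
noncomputable def residueConst (n m : ℕ) : ℝ :=
  (ascPochhammer ℝ m).eval ((n : ℝ) - 1) / Real.Gamma m

theorem residueConst_pos {n m : ℕ} (hn : 2 < n) (hm : 0 < m) : 0 < residueConst n m := by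
  have hn' : (2 : ℝ) < n := by exact_mod_cast hn
  exact div_pos (ascPochhammer_pos _ _ (by linarith)) (Real.Gamma_pos_of_pos (by exact_mod_cast hm))

theorem ofReal_residueConst (n m : ℕ) : ((residueConst n m : ℝ) : ℂ) =
    (ascPochhammer ℂ m).eval ((n : ℂ) - 1) / Complex.Gamma (m : ℂ) := by
  rw [residueConst, Complex.ofReal_div, ← Complex.Gamma_ofReal, Complex.ofReal_natCast]
  congr 1
  have := Polynomial.eval₂_at_apply (p := ascPochhammer ℝ m) Complex.ofRealHom ((n : ℝ) - 1)
  rw [← Polynomial.eval_map, ascPochhammer_map] at this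
  simpa using this.symm

theorem radialFactor_eq {n m : ℕ} (hn : 2 < n) (hm : 0 < m) {t : ℝ} (ht0 : 0 ≤ t) (ht : t < 1) :
    radialFactor n m t = residueConst n m * eulerIntegral m (n / 2) t := by
  have hn' : (2 : ℝ) < n := by exact_mod_cast hn
  have hm' : (0 : ℝ) < m := by exact_mod_cast hm
  have hn2 : (0 : ℝ) < n / 2 := by positivity
  rw [eulerIntegral_eq m hm (by linarith) ht0 ht, radialFactor, residueConst,
    ascPochhammer_eval_eq_Gamma_div hn2, add_comm ((n : ℝ) / 2)]
  have g1 := (Real.Gamma_pos_of_pos hm').ne'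
  have g2 := (Real.Gamma_pos_of_pos (by positivity : 0 < (m : ℝ) + n / 2)).ne'
  have g3 := (Real.Gamma_pos_of_pos hn2).ne'
  field_simp

/-- This is the normalisation S_m(1) = 1. It explains why the residue is linear in K although the
weight carries K². -/
theorem residueConst_mul_eulerIntegral_one {n m : ℕ} (hn : 2 < n) (hm : 0 < m) :
    residueConst n m * eulerIntegral m (n / 2) 1 = 1 := by
  have hn' : (2 : ℝ) < n := by exact_mod_cast hn
  have hm' : (0 : ℝ) < m := by exact_mod_cast hm
  have hn1 : (0 : ℝ) < n - 1 := by linarith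
  rw [eulerIntegral_one m hm (by linarith), residueConst, ascPochhammer_eval_eq_Gamma_div hn1,
    show 2 * ((n : ℝ) / 2) - 1 = n - 1 by ring, add_comm ((n : ℝ) - 1)]
  have g1 := (Real.Gamma_pos_of_pos hm').ne'
  have g2 := (Real.Gamma_pos_of_pos (by positivity : 0 < (m : ℝ) + (n - 1))).ne'
  have g3 := (Real.Gamma_pos_of_pos hn1).ne'
  field_simp

/-! ### Mellin transforms of power series -/

/-- `δ^z ∑ aₖ δ^k / (z + k)`, the continuation of the Mellin transform of `∑ aₖ x^k` on `(0, δ]`. -/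
noncomputable def mellinSeries (δ : ℝ) (a : ℕ → ℂ) (z : ℂ) : ℂ :=
  (δ : ℂ) ^ z * ∑' k : ℕ, a k * (δ : ℂ) ^ k / (z + k)

section MellinSeries

variable {δ : ℝ} {a : ℕ → ℂ}

theorem norm_le_of_one_le_norm_add {N : ℕ} {z₀ z : ℂ} (hN : ‖z₀‖ + 2 ≤ N)
    (hz : z ∈ Metric.ball z₀ 1) (k : ℕ) : 1 ≤ ‖z + (k + N : ℕ)‖ := by
  rw [mem_ball_iff_norm] at hz
  have h1 : ‖((k + N : ℕ) : ℂ)‖ ≤ ‖z + (k + N : ℕ)‖ + ‖z‖ := by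
    simpa using norm_sub_le (z + (k + N : ℕ)) z
  have h2 : ‖z‖ ≤ ‖z - z₀‖ + ‖z₀‖ := by simpa using norm_add_le (z - z₀) z₀
  rw [Complex.norm_natCast] at h1
  push_cast at h1
  have : (0 : ℝ) ≤ k := by positivity
  push_cast
  linarith

theorem norm_mellinSeries_tail_le (hδ : 0 < δ) {N : ℕ} {z₀ z : ℂ} (hN : ‖z₀‖ + 2 ≤ N)
    (hz : z ∈ Metric.ball z₀ 1) (k : ℕ) :
    ‖a (k + N) * (δ : ℂ) ^ (k + N) / (z + (k + N : ℕ))‖ ≤ ‖a (k + N)‖ * δ ^ (k + N) := by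
  have := norm_le_of_one_le_norm_add hN hz k
  rw [norm_div, norm_mul, norm_pow, Complex.norm_real, Real.norm_of_nonneg hδ.le]
  exact div_le_self (by positivity) this

theorem summable_mellinSeries (hδ : 0 < δ) (ha : Summable fun k => ‖a k‖ * δ ^ k) (z : ℂ) :
    Summable fun k : ℕ => a k * (δ : ℂ) ^ k / (z + k) := by
  obtain ⟨N, hN⟩ := exists_nat_ge (‖z‖ + 2)
  rw [← summable_nat_add_iff N]
  exact Summable.of_norm_bounded ((summable_nat_add_iff N).2 ha) fun k =>
    norm_mellinSeries_tail_le hδ hN (Metric.mem_ball_self one_pos) k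

/-- On the unit ball around z₀ the denominators z + k + N have modulus at least 1, so the tail
converges uniformly there. Poles near z₀ can come only from the finite head. -/
theorem analyticAt_mellinSeries_tail (hδ : 0 < δ) (ha : Summable fun k => ‖a k‖ * δ ^ k)
    {N : ℕ} {z₀ : ℂ} (hN : ‖z₀‖ + 2 ≤ N) :
    AnalyticAt ℂ (fun z : ℂ => ∑' k : ℕ, a (k + N) * (δ : ℂ) ^ (k + N) / (z + (k + N : ℕ))) z₀ := by
  have : DifferentiableOn ℂ
      (fun z : ℂ => ∑' k : ℕ, a (k + N) * (δ : ℂ) ^ (k + N) / (z + (k + N : ℕ)))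
      (Metric.ball z₀ 1) := by
    refine Complex.differentiableOn_tsum_of_summable_norm ((summable_nat_add_iff N).2 ha) (fun k z hz => ?_)
      Metric.isOpen_ball fun k z hz => norm_mellinSeries_tail_le hδ hN hz k
    have h1 := norm_le_of_one_le_norm_add hN hz k
    have h2 : z + (k + N : ℕ) ≠ 0 := norm_pos_iff.1 (by linarith)
    have h3 : DifferentiableAt ℂ (fun z : ℂ => z + (k + N : ℕ)) z := by fun_prop
    exact ((differentiableAt_const _).fun_div h3 h2).differentiableWithinAt
  exact this.analyticAt (Metric.isOpen_ball.mem_nhds (Metric.mem_ball_self one_pos))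

theorem mellinSeries_eq (hδ : 0 < δ) (ha : Summable fun k => ‖a k‖ * δ ^ k) (N : ℕ) (z : ℂ) :
    mellinSeries δ a z = (δ : ℂ) ^ z * (∑ k ∈ Finset.range N, a k * (δ : ℂ) ^ k / (z + k) +
      ∑' k : ℕ, a (k + N) * (δ : ℂ) ^ (k + N) / (z + (k + N : ℕ))) := by
  rw [mellinSeries, (summable_mellinSeries hδ ha z).sum_add_tsum_nat_add N]

theorem analyticAt_ofReal_cpow (hδ : 0 < δ) (z : ℂ) : AnalyticAt ℂ (fun z : ℂ => (δ : ℂ) ^ z) z :=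
  AnalyticAt.cpow analyticAt_const analyticAt_id
    (Complex.mem_slitPlane_iff.2 (Or.inl (by simpa using hδ)))

theorem meromorphic_mellinSeries (hδ : 0 < δ) (ha : Summable fun k => ‖a k‖ * δ ^ k) :
    Meromorphic (mellinSeries δ a) := by
  intro z₀
  obtain ⟨N, hN⟩ := exists_nat_ge (‖z₀‖ + 2)
  rw [funext (mellinSeries_eq hδ ha N)]
  refine (analyticAt_ofReal_cpow hδ z₀).meromorphicAt.mul (MeromorphicAt.add ?_
    (analyticAt_mellinSeries_tail hδ ha hN).meromorphicAt)
  exact MeromorphicAt.fun_sum fun k _ => (MeromorphicAt.const _ _).div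
    ((MeromorphicAt.id _).add (MeromorphicAt.const _ _))

theorem analyticAt_mellinSeries (hδ : 0 < δ) (ha : Summable fun k => ‖a k‖ * δ ^ k)
    {z₀ : ℂ} (hz₀ : 0 < z₀.re) : AnalyticAt ℂ (mellinSeries δ a) z₀ := by
  obtain ⟨N, hN⟩ := exists_nat_ge (‖z₀‖ + 2)
  rw [funext (mellinSeries_eq hδ ha N)]
  refine (analyticAt_ofReal_cpow hδ z₀).mul (AnalyticAt.add ?_
    (analyticAt_mellinSeries_tail hδ ha hN))
  refine Finset.analyticAt_fun_sum _ fun k _ => analyticAt_const.div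
    (analyticAt_id.add analyticAt_const) fun h => ?_
  have := congrArg Complex.re h
  simp only [Complex.add_re, Complex.natCast_re, Complex.zero_re] at this
  have : (0 : ℝ) ≤ k := by positivity
  linarith

theorem summable_norm_shift (hδ : 0 < δ) (ha : Summable fun k => ‖a k‖ * δ ^ k) :
    Summable fun k => ‖a (k + 1)‖ * δ ^ k := by
  have := ((summable_nat_add_iff 1).2 ha).mul_right δ⁻¹
  refine this.congr fun k => ?_
  rw [pow_succ]
  field_simp

/-- Removing the term k = 0 leaves a series of the same kind at z + 1, one factor δ being absorbed
into δ^(z+1). This moves the pole at -(j+1) to -j and drives the induction for residues. -/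
theorem mellinSeries_succ (hδ : 0 < δ) (ha : Summable fun k => ‖a k‖ * δ ^ k) (z : ℂ) :
    mellinSeries δ a z =
      (δ : ℂ) ^ z * a 0 / z + mellinSeries δ (fun k => a (k + 1)) (z + 1) := by
  have hδ' : (δ : ℂ) ≠ 0 := by exact_mod_cast hδ.ne'
  rw [mellinSeries_eq hδ ha 1, mellinSeries, mul_add, Complex.cpow_add _ _ hδ', Complex.cpow_one]
  congr 1
  · simp [div_eq_mul_inv, mul_assoc]
  · rw [mul_assoc, ← tsum_mul_left (a := (δ : ℂ))]
    congr 2 with k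
    push_cast
    ring

/-- `mellinSeries` has residue `a j` at `-j`. -/
theorem tendsto_mellinSeries (hδ : 0 < δ) (j : ℕ) (ha : Summable fun k => ‖a k‖ * δ ^ k) :
    Tendsto (fun z => (z + j) * mellinSeries δ a z) (𝓝[≠] (-(j : ℂ))) (𝓝 (a j)) := by
  have hδ' : (δ : ℂ) ≠ 0 := by exact_mod_cast hδ.ne'
  induction j generalizing a with
  | zero =>
    have h1 : Tendsto (fun z : ℂ => (δ : ℂ) ^ z * a 0 +
        z * mellinSeries δ (fun k => a (k + 1)) (z + 1)) (𝓝[≠] 0) (𝓝 (a 0)) := by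
      have hc : ContinuousAt (fun z : ℂ => (δ : ℂ) ^ z * a 0 +
          z * mellinSeries δ (fun k => a (k + 1)) (z + 1)) 0 := by
        refine ((analyticAt_ofReal_cpow hδ 0).continuousAt.mul continuousAt_const).add
          (continuousAt_id.mul ?_)
        exact ContinuousAt.comp (f := fun z : ℂ => z + 1)
          (analyticAt_mellinSeries hδ (summable_norm_shift hδ ha) (by simp)).continuousAt
          (by fun_prop)
      have := hc.tendsto.mono_left (nhdsWithin_le_nhds (s := {0}ᶜ))
      simpa using this
    simp only [Nat.cast_zero, neg_zero, add_zero]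
    refine h1.congr' ?_
    filter_upwards [self_mem_nhdsWithin] with z hz
    have hz' : z ≠ 0 := hz
    rw [mellinSeries_succ hδ ha z]
    field_simp
  | succ j ih =>
    have h1 := ih (summable_norm_shift hδ ha)
    have h2 : Tendsto (fun z : ℂ => z + 1) (𝓝[≠] (-((j + 1 : ℕ) : ℂ))) (𝓝[≠] (-(j : ℂ))) := by
      refine tendsto_nhdsWithin_iff.2 ⟨?_, ?_⟩
      · have : ContinuousAt (fun z : ℂ => z + 1) (-((j + 1 : ℕ) : ℂ)) := by fun_prop
        have := this.tendsto.mono_left (nhdsWithin_le_nhds (s := {(-((j + 1 : ℕ) : ℂ))}ᶜ))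
        convert this using 2
        push_cast
        ring
      · filter_upwards [self_mem_nhdsWithin] with z hz h
        refine hz ?_
        rw [Set.mem_singleton_iff] at h ⊢
        rw [eq_sub_of_add_eq h]
        push_cast
        ring
    have h3 : Tendsto (fun z : ℂ => (z + (j + 1 : ℕ)) * ((δ : ℂ) ^ z * a 0 / z))
        (𝓝[≠] (-((j + 1 : ℕ) : ℂ))) (𝓝 0) := by
      have hne : -((j + 1 : ℕ) : ℂ) ≠ 0 := neg_ne_zero.2 (Nat.cast_ne_zero.2 (Nat.succ_ne_zero _))
      have hc : ContinuousAt (fun z : ℂ => (z + (j + 1 : ℕ)) * ((δ : ℂ) ^ z * a 0 / z))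
          (-((j + 1 : ℕ) : ℂ)) :=
        (by fun_prop : ContinuousAt (fun z : ℂ => z + (j + 1 : ℕ)) _).mul
          (((analyticAt_ofReal_cpow hδ _).continuousAt.mul continuousAt_const).div
            continuousAt_id hne)
      have := hc.tendsto.mono_left (nhdsWithin_le_nhds (s := {(-((j + 1 : ℕ) : ℂ))}ᶜ))
      simpa using this
    have h4 := h3.add (h1.comp h2)
    rw [zero_add] at h4
    refine h4.congr fun z => ?_
    rw [mellinSeries_succ hδ ha z, Function.comp_apply]
    push_cast
    ring

theorem mellin_indicator_powerSeries (hδ : 0 < δ) (ha : Summable fun k => ‖a k‖ * δ ^ k)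
    {z : ℂ} (hz : 0 < z.re) :
    mellin (Set.indicator (Set.Ioc 0 δ) fun x : ℝ => ∑' k, a k * (x : ℂ) ^ k) z =
      mellinSeries δ a z := by
  have h0 : mellin (Set.indicator (Set.Ioc 0 δ) fun x : ℝ => ∑' k, a k * (x : ℂ) ^ k) z =
      ∫ x in (0 : ℝ)..δ, (x : ℂ) ^ (z - 1) * ∑' k, a k * (x : ℂ) ^ k := by
    simp_rw [mellin, ← Set.indicator_smul]
    rw [integral_indicator measurableSet_Ioc, intervalIntegral.integral_of_le hδ.le,
      Measure.restrict_restrict_of_subset Set.Ioc_subset_Ioi_self]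
    rfl
  have hzr : -1 < (z - 1).re := by simpa using hz
  have hδ' : (δ : ℂ) ≠ 0 := by exact_mod_cast hδ.ne'
  have hS : HasSum (fun k : ℕ => ∫ x in (0 : ℝ)..δ, (x : ℂ) ^ (z - 1) * (a k * (x : ℂ) ^ k))
      (∫ x in (0 : ℝ)..δ, (x : ℂ) ^ (z - 1) * ∑' k, a k * (x : ℂ) ^ k) := by
    have hx : ∀ x ∈ Set.uIoc (0 : ℝ) δ, 0 < x ∧ x ≤ δ := fun x hx => by
      rwa [Set.uIoc_of_le hδ.le] at hx
    have hb : ∀ k, ∀ x ∈ Set.uIoc (0 : ℝ) δ, ‖a k * (x : ℂ) ^ k‖ ≤ ‖a k‖ * δ ^ k :=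
      fun k x hx' => by
        obtain ⟨h1, h2⟩ := hx x hx'
        rw [norm_mul, norm_pow, Complex.norm_real, Real.norm_of_nonneg h1.le]
        gcongr
    refine intervalIntegral.hasSum_integral_of_dominated_convergence
      (fun k x => x ^ ((z - 1).re) * (‖a k‖ * δ ^ k)) (fun k => ?_) (fun k => ?_) ?_ ?_ ?_
    · refine AEStronglyMeasurable.mul ?_ (by fun_prop)
      exact (intervalIntegrable_iff.1
        (intervalIntegral.intervalIntegrable_cpow' hzr)).aestronglyMeasurable
    · refine ae_of_all _ fun x hx' => ?_
      rw [norm_mul, Complex.norm_cpow_eq_rpow_re_of_pos (hx x hx').1]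
      exact mul_le_mul_of_nonneg_left (hb k x hx') (Real.rpow_nonneg (hx x hx').1.le _)
    · exact ae_of_all _ fun x _ => ha.mul_left _
    · simp_rw [tsum_mul_left]
      exact (intervalIntegral.intervalIntegrable_rpow' hzr).mul_const _
    · refine ae_of_all _ fun x hx' => ?_
      exact (Summable.of_norm_bounded ha fun k => hb k x hx').hasSum.mul_left _
  rw [h0, ← hS.tsum_eq, mellinSeries, ← tsum_mul_left]
  refine tsum_congr fun k => ?_
  have hzk : z + k ≠ 0 := fun h => by
    have := congrArg Complex.re h
    simp only [Complex.add_re, Complex.natCast_re, Complex.zero_re] at this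
    have : (0 : ℝ) ≤ k := by positivity
    linarith
  have e : ∫ x in (0 : ℝ)..δ, (x : ℂ) ^ (z - 1) * (a k * (x : ℂ) ^ k) =
      ∫ x in (0 : ℝ)..δ, a k * (x : ℂ) ^ (z - 1 + k) := by
    refine intervalIntegral.integral_congr_ae (ae_of_all _ fun x hx' => ?_)
    rw [Set.uIoc_of_le hδ.le] at hx'
    rw [Complex.cpow_add _ _ (by exact_mod_cast hx'.1.ne'), Complex.cpow_natCast]
    ring
  have hk : -1 < (z - 1 + k).re := by
    simp only [Complex.add_re, Complex.natCast_re]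
    have : (0 : ℝ) ≤ k := by positivity
    linarith
  rw [e, intervalIntegral.integral_const_mul, integral_cpow (Or.inl hk),
    show z - 1 + k + 1 = z + k by ring, Complex.ofReal_zero, Complex.zero_cpow hzk, sub_zero,
    Complex.cpow_add _ _ hδ', Complex.cpow_natCast]
  ring

end MellinSeries

/-! ### Double poles from logarithms -/

/-- A punctured-neighbourhood limit of `(z - z₀) F` gives one of `(z - z₀)² F'`. -/
theorem tendsto_sq_mul_deriv {F : ℂ → ℂ} {z₀ ρ : ℂ} (hF : MeromorphicAt F z₀)
    (h : Tendsto (fun z => (z - z₀) * F z) (𝓝[≠] z₀) (𝓝 ρ)) :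
    Tendsto (fun z => (z - z₀) ^ 2 * deriv F z) (𝓝[≠] z₀) (𝓝 (-ρ)) := by
  have hsub : MeromorphicAt (fun z => (z - z₀) * F z) z₀ :=
    ((MeromorphicAt.id _).sub (MeromorphicAt.const _ _)).mul hF
  -- H fills the removable singularity of (z - z₀) F with the value ρ; being meromorphic and
  -- continuous it is analytic, and (z - z₀)² F' = (z - z₀) H' - H.
  set H : ℂ → ℂ := Function.update (fun z => (z - z₀) * F z) z₀ ρ with hH
  have hHe : ∀ z, z ≠ z₀ → H z = (z - z₀) * F z := fun z hz => Function.update_of_ne hz _ _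
  have hH0 : H z₀ = ρ := Function.update_self _ _ _
  have hHm : MeromorphicAt H z₀ := hsub.congr (by
    filter_upwards [self_mem_nhdsWithin] with z hz
    exact (hHe z hz).symm)
  have hHc : ContinuousAt H z₀ := by
    rw [continuousAt_update_same]
    exact h
  have hHa : AnalyticAt ℂ H z₀ := hHm.analyticAt hHc
  have hlim : Tendsto (fun z => (z - z₀) * deriv H z - H z) (𝓝[≠] z₀) (𝓝 (-ρ)) := by
    have hc : ContinuousAt (fun z => (z - z₀) * deriv H z - H z) z₀ :=
      ((by fun_prop : ContinuousAt (fun z : ℂ => z - z₀) z₀).mul hHa.deriv.continuousAt).sub hHc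
    have := hc.tendsto.mono_left (nhdsWithin_le_nhds (s := {z₀}ᶜ))
    simpa [hH0] using this
  refine hlim.congr' ?_
  filter_upwards [self_mem_nhdsWithin, hHa.eventually_analyticAt.filter_mono nhdsWithin_le_nhds]
    with z hz hza
  have hz' : z - z₀ ≠ 0 := sub_ne_zero.2 hz
  have hev : F =ᶠ[𝓝 z] fun w => H w / (w - z₀) := by
    filter_upwards [isOpen_ne.mem_nhds hz] with w hw
    rw [hHe w hw]
    field_simp [sub_ne_zero.2 hw]
  rw [hev.deriv_eq, deriv_fun_div hza.differentiableAt (by fun_prop) hz']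
  simp only [deriv_sub_const, deriv_id'']
  field_simp

theorem tendsto_sq_mul_of_tendsto_mul {F : ℂ → ℂ} {z₀ ρ : ℂ}
    (h : Tendsto (fun z => (z - z₀) * F z) (𝓝[≠] z₀) (𝓝 ρ)) :
    Tendsto (fun z => (z - z₀) ^ 2 * F z) (𝓝[≠] z₀) (𝓝 0) := by
  have hc : ContinuousAt (fun z : ℂ => z - z₀) z₀ := by fun_prop
  have h1 := hc.tendsto.mono_left (nhdsWithin_le_nhds (s := {z₀}ᶜ))
  have := h1.mul h
  simp only [sub_self, zero_mul] at this
  refine this.congr fun z => ?_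
  ring

section LogDerivatives

variable {f : ℝ → ℂ}

theorem isBigO_atTop_of_eq_zero {R : ℝ} (h : ∀ x, R < x → f x = 0) (g : ℝ → ℝ) :
    f =O[atTop] g :=
  (EventuallyEq.trans_isBigO (f₂ := fun _ => (0 : ℂ))
    (by filter_upwards [eventually_gt_atTop R] with x hx using h x hx)
    (Asymptotics.isBigO_zero _ _))

/-- Vanishing beyond R provides any decay at infinity, so only the growth at 0 restricts the
half-plane. -/
theorem hasDerivAt_mellin_of_compactSupport {R b : ℝ} (hf : LocallyIntegrableOn f (Set.Ioi 0))
    (hR : ∀ x, R < x → f x = 0) (hb : f =O[𝓝[>] 0] (· ^ (-b))) {z : ℂ} (hz : b < z.re) :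
    MellinConvergent f z ∧ MellinConvergent (fun t => Real.log t • f t) z ∧
      HasDerivAt (mellin f) (mellin (fun t => Real.log t • f t) z) z :=
  ⟨mellinConvergent_of_isBigO_rpow hf (isBigO_atTop_of_eq_zero hR _) (lt_add_one _) hb hz,
    mellin_hasDerivAt_of_isBigO_rpow hf (isBigO_atTop_of_eq_zero hR _) (lt_add_one _) hb hz⟩

theorem locallyIntegrableOn_log_smul (hf : LocallyIntegrableOn f (Set.Ioi 0)) :
    LocallyIntegrableOn (fun t => Real.log t • f t) (Set.Ioi 0) :=
  hf.continuousOn_smul isOpen_Ioi.isLocallyClosed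
    (Real.continuousOn_log.mono fun _ hx => (Set.mem_Ioi.1 hx).ne')

/-- Multiplying by a logarithm differentiates the Mellin transform, as long as the function is
compactly supported and bounded near `0`. -/
theorem mellin_log_smul_eq_deriv {R : ℝ} (hf : LocallyIntegrableOn f (Set.Ioi 0))
    (hR : ∀ x, R < x → f x = 0) (hb : ∀ b : ℝ, 0 < b → f =O[𝓝[>] 0] (· ^ (-b))) {G : ℂ → ℂ}
    (hG : ∀ z : ℂ, 0 < z.re → mellin f z = G z) {z : ℂ} (hz : 0 < z.re) :
    mellin (fun t => Real.log t • f t) z = deriv G z := by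
  obtain ⟨b, hb0, hbz⟩ := exists_between hz
  have h := (hasDerivAt_mellin_of_compactSupport hf hR (hb b hb0) hbz).2.2
  rw [← h.deriv]
  refine Filter.EventuallyEq.deriv_eq ?_
  filter_upwards [(isOpen_lt continuous_const Complex.continuous_re).mem_nhds hz] with w hw
  exact hG w hw

end LogDerivatives

section PowerSeriesPiece

variable {δ : ℝ} {a : ℕ → ℂ}

theorem continuousOn_powerSeries (ha : Summable fun k => ‖a k‖ * δ ^ k) :
    ContinuousOn (fun x : ℝ => ∑' k, a k * (x : ℂ) ^ k) (Set.Icc 0 δ) := by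
  refine continuousOn_tsum (fun k => by fun_prop) ha fun k x hx => ?_
  rw [norm_mul, norm_pow, Complex.norm_real, Real.norm_of_nonneg hx.1]
  exact mul_le_mul_of_nonneg_left (pow_le_pow_left₀ hx.1 hx.2 k) (norm_nonneg _)

theorem isBigO_rpow_neg_of_bounded {f : ℝ → ℂ} {C : ℝ} (hf : ∀ᶠ x in 𝓝[>] (0 : ℝ), ‖f x‖ ≤ C)
    {b : ℝ} (hb : 0 < b) : f =O[𝓝[>] 0] (fun x : ℝ => x ^ (-b)) := by
  refine Asymptotics.IsBigO.of_bound |C| ?_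
  filter_upwards [hf, Ioo_mem_nhdsGT (show (0 : ℝ) < 1 by norm_num)] with x hx hx'
  have h1 : 1 ≤ x ^ (-b) := Real.one_le_rpow_of_pos_of_le_one_of_nonpos hx'.1 hx'.2.le (by linarith)
  rw [Real.norm_of_nonneg (by linarith)]
  nlinarith [le_abs_self C, abs_nonneg C]

variable (δ a) in
/-- `∑ aₖ x^k` on `(0, δ]`, extended by zero. -/
noncomputable def truncSeries : ℝ → ℂ :=
  Set.indicator (Set.Ioc 0 δ) fun x : ℝ => ∑' k, a k * (x : ℂ) ^ k

theorem truncSeries_of_lt {x : ℝ} (hx : δ < x) : truncSeries δ a x = 0 :=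
  Set.indicator_of_notMem (fun h => absurd h.2 (not_le.2 hx)) _

theorem locallyIntegrableOn_truncSeries (ha : Summable fun k => ‖a k‖ * δ ^ k) :
    LocallyIntegrableOn (truncSeries δ a) (Set.Ioi 0) := by
  refine Integrable.locallyIntegrable ?_ |>.locallyIntegrableOn _
  refine (integrable_indicator_iff measurableSet_Ioc).2 ?_
  exact ((continuousOn_powerSeries ha).integrableOn_compact isCompact_Icc).mono_set
    Set.Ioc_subset_Icc_self

theorem isBigO_truncSeries (hδ : 0 < δ) (ha : Summable fun k => ‖a k‖ * δ ^ k) {b : ℝ}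
    (hb : 0 < b) : truncSeries δ a =O[𝓝[>] 0] (fun x : ℝ => x ^ (-b)) := by
  obtain ⟨C, hC⟩ := isCompact_Icc.exists_bound_of_continuousOn (continuousOn_powerSeries ha)
  refine isBigO_rpow_neg_of_bounded (C := C) ?_ hb
  filter_upwards [Ioc_mem_nhdsGT hδ] with x hx
  rw [truncSeries, Set.indicator_of_mem hx]
  exact hC x ⟨hx.1.le, hx.2⟩

/-- A logarithm costs an arbitrarily small power. Asking for the bound for every b > 0 makes the
condition stable under multiplication by log, so it can be iterated. -/
theorem isBigO_log_smul {f : ℝ → ℂ}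
    (hf : ∀ b : ℝ, 0 < b → f =O[𝓝[>] 0] (fun x : ℝ => x ^ (-b))) {b : ℝ} (hb : 0 < b) :
    (fun t => Real.log t • f t) =O[𝓝[>] 0] (fun x : ℝ => x ^ (-b)) :=
  isBigO_rpow_zero_log_smul (half_lt_self hb) (hf _ (half_pos hb))

theorem mellin_truncSeries (hδ : 0 < δ) (ha : Summable fun k => ‖a k‖ * δ ^ k)
    {z : ℂ} (hz : 0 < z.re) : mellin (truncSeries δ a) z = mellinSeries δ a z :=
  mellin_indicator_powerSeries hδ ha hz

theorem mellin_log_truncSeries (hδ : 0 < δ) (ha : Summable fun k => ‖a k‖ * δ ^ k)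
    {z : ℂ} (hz : 0 < z.re) :
    mellin (fun t => Real.log t • truncSeries δ a t) z = deriv (mellinSeries δ a) z :=
  mellin_log_smul_eq_deriv (locallyIntegrableOn_truncSeries ha)
    (fun _ hx => truncSeries_of_lt hx) (fun _ => isBigO_truncSeries hδ ha)
    (fun _ => mellin_truncSeries hδ ha) hz

theorem mellin_log_log_truncSeries (hδ : 0 < δ) (ha : Summable fun k => ‖a k‖ * δ ^ k)
    {z : ℂ} (hz : 0 < z.re) :
    mellin (fun t => Real.log t • Real.log t • truncSeries δ a t) z =
      deriv (deriv (mellinSeries δ a)) z :=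
  mellin_log_smul_eq_deriv (R := δ) (f := fun t => Real.log t • truncSeries δ a t)
    (locallyIntegrableOn_log_smul (locallyIntegrableOn_truncSeries ha))
    (fun _ hx => by simp [truncSeries_of_lt hx])
    (fun _ => isBigO_log_smul fun _ => isBigO_truncSeries hδ ha)
    (fun _ => mellin_log_truncSeries hδ ha) hz

end PowerSeriesPiece

/-! ### Continuation from a logarithmic expansion -/

/-- Coefficients of a real-analytic function, with a radius of absolute convergence. -/
theorem AnalyticAt.exists_powerSeries {A : ℝ → ℂ} (hA : AnalyticAt ℝ A 0) :
    ∃ (a : ℕ → ℂ) (r : ℝ), 0 < r ∧ a 0 = A 0 ∧ ∀ δ, 0 < δ → δ < r →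
      (Summable fun k => ‖a k‖ * δ ^ k) ∧ ∀ x : ℝ, 0 ≤ x → x ≤ δ →
        A x = ∑' k, a k * (x : ℂ) ^ k := by
  obtain ⟨p, R, hp⟩ := hA
  obtain ⟨r, hr0, hrR⟩ := ENNReal.lt_iff_exists_nnreal_btwn.1 hp.r_pos
  refine ⟨p.coeff, r, by exact_mod_cast hr0, ?_, fun δ hδ hδr => ⟨?_, fun x hx0 hx => ?_⟩⟩
  · exact hp.coeff_zero _
  · lift δ to NNReal using hδ.le
    have h := p.summable_norm_mul_pow (r := δ)
      ((by exact_mod_cast hδr : (δ : ENNReal) < r).trans (hrR.trans_le hp.r_le))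
    refine h.congr fun k => ?_
    rw [FormalMultilinearSeries.norm_apply_eq_norm_coef]
  · have hx' : x ∈ Metric.eball (0 : ℝ) R := by
      rw [Metric.mem_eball, edist_zero_right]
      refine lt_trans ?_ hrR
      rw [enorm_eq_nnnorm]
      have : ‖x‖ < r := by rw [Real.norm_of_nonneg hx0]; linarith
      exact_mod_cast this
    have h := hp.hasSum hx'
    rw [zero_add] at h
    rw [← h.tsum_eq]
    refine tsum_congr fun k => ?_
    rw [FormalMultilinearSeries.apply_eq_pow_smul_coeff, Complex.real_smul]
    push_cast
    ring

theorem tendsto_add_const_nhdsNE (c z₀ : ℂ) : Tendsto (fun z => z + c) (𝓝[≠] z₀) (𝓝[≠] (z₀ + c)) := by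
  refine tendsto_nhdsWithin_iff.2 ⟨?_, ?_⟩
  · exact (by fun_prop : ContinuousAt (fun z : ℂ => z + c) z₀).tendsto.mono_left nhdsWithin_le_nhds
  · filter_upwards [self_mem_nhdsWithin] with z hz h
    exact hz (add_right_cancel h)

theorem locallyIntegrableOn_indicator_Ioi {g : ℝ → ℂ} (hg : LocallyIntegrableOn g (Set.Ioi 0))
    (δ : ℝ) : LocallyIntegrableOn (Set.indicator (Set.Ioi δ) g) (Set.Ioi 0) := by
  intro x hx
  obtain ⟨t, ht, hi⟩ := hg x hx
  exact ⟨t, ht, hi.indicator measurableSet_Ioi⟩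

/-- Away from 0 and ∞ nothing obstructs convergence: this part is entire and contributes no poles.
-/
theorem analyticAt_mellin_indicator_Ioi {g : ℝ → ℂ} {R δ : ℝ} (hδ : 0 < δ)
    (hg : LocallyIntegrableOn g (Set.Ioi 0)) (hR : ∀ x, R < x → g x = 0) (z : ℂ) :
    MellinConvergent (Set.indicator (Set.Ioi δ) g) z ∧
      AnalyticAt ℂ (mellin (Set.indicator (Set.Ioi δ) g)) z := by
  have hb : ∀ b : ℝ, Set.indicator (Set.Ioi δ) g =O[𝓝[>] 0] (fun x : ℝ => x ^ (-b)) := fun b =>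
    EventuallyEq.trans_isBigO (f₂ := fun _ => (0 : ℂ)) (by
      filter_upwards [Ioo_mem_nhdsGT hδ] with x hx
      exact Set.indicator_of_notMem (fun h => absurd hx.2 (not_lt.2 (Set.mem_Ioi.1 h).le)) _)
      (Asymptotics.isBigO_zero _ _)
  have h := fun z : ℂ => hasDerivAt_mellin_of_compactSupport
    (locallyIntegrableOn_indicator_Ioi hg δ) (R := R)
    (fun x hx => by simp [Set.indicator, hR x hx]) (hb (z.re - 1)) (sub_one_lt z.re)
  exact ⟨(h z).1, Differentiable.analyticAt (fun w => (h w).2.2.differentiableAt) z⟩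

/-- Meromorphic continuation of the Mellin transform of a compactly supported function with a
logarithmic expansion at the origin. -/
theorem exists_mellin_continuation {g A₀ A₁ A₂ : ℝ → ℂ} {R : ℝ} {N : ℕ} (hN : 0 < N)
    (hg : LocallyIntegrableOn g (Set.Ioi 0)) (hR : ∀ x, R < x → g x = 0)
    (h₀ : AnalyticAt ℝ A₀ 0) (h₁ : AnalyticAt ℝ A₁ 0) (h₂ : AnalyticAt ℝ A₂ 0)
    (hexp : ∀ᶠ x in 𝓝[>] (0 : ℝ), g x = A₀ x + (x : ℂ) ^ N * (Real.log x * A₁ x) +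
      (x : ℂ) ^ (2 * N) * (Real.log x * (Real.log x * A₂ x))) :
    ∃ M : ℂ → ℂ, Meromorphic M ∧ (∀ z : ℂ, 0 < z.re → M z = mellin g z) ∧
      Tendsto (fun z => (z + N) ^ 2 * M z) (𝓝[≠] (-(N : ℂ))) (𝓝 (-A₁ 0)) := by
  obtain ⟨a₀, r₀, hr₀, -, ha₀⟩ := h₀.exists_powerSeries
  obtain ⟨a₁, r₁, hr₁, ha₁0, ha₁⟩ := h₁.exists_powerSeries
  obtain ⟨a₂, r₂, hr₂, -, ha₂⟩ := h₂.exists_powerSeries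
  obtain ⟨r, hr, hexp⟩ := mem_nhdsGT_iff_exists_Ioo_subset.1 hexp
  -- The cut δ lies inside all three radii of convergence and inside the interval where the
  -- expansion holds.
  obtain ⟨δ, hδ, hδr⟩ := exists_between
    (lt_min (lt_min hr₀ hr₁) (lt_min hr₂ (Set.mem_Ioi.1 hr)))
  obtain ⟨s₀, e₀⟩ := ha₀ δ hδ (hδr.trans_le ((min_le_left _ _).trans (min_le_left _ _)))
  obtain ⟨s₁, e₁⟩ := ha₁ δ hδ (hδr.trans_le ((min_le_left _ _).trans (min_le_right _ _)))
  obtain ⟨s₂, e₂⟩ := ha₂ δ hδ (hδr.trans_le ((min_le_right _ _).trans (min_le_left _ _)))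
  have hδr' : δ < r := hδr.trans_le ((min_le_right _ _).trans (min_le_right _ _))
  set E : ℂ → ℂ := mellin (Set.indicator (Set.Ioi δ) g) with hE
  have hEan := analyticAt_mellin_indicator_Ioi hδ hg hR
  set G₀ := mellinSeries δ a₀
  set G₁ := mellinSeries δ a₁
  set G₂ := mellinSeries δ a₂
  have hm₀ : Meromorphic G₀ := meromorphic_mellinSeries hδ s₀
  have hm₁ : Meromorphic G₁ := meromorphic_mellinSeries hδ s₁
  have hm₂ : Meromorphic G₂ := meromorphic_mellinSeries hδ s₂
  -- A factor x^N shifts z to z + N and each logarithm is one derivative; E is the part of g beyond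
  -- δ.
  have hm : Meromorphic fun z : ℂ =>
      G₀ z + deriv G₁ (z + N) + deriv (deriv G₂) (z + (2 * N : ℕ)) + E z := by
    refine ((hm₀.add ?_).add ?_).add fun z => (hEan z).2.meromorphicAt
    · exact Meromorphic.meromorphic_fun_comp_add_const_iff_meromorphic.2 hm₁.deriv
    · exact Meromorphic.meromorphic_fun_comp_add_const_iff_meromorphic.2 hm₂.deriv.deriv
  refine ⟨_, hm, fun z hz => ?_, ?_⟩
  · have hz₁ : 0 < (z + (N : ℂ)).re := by
      simp only [Complex.add_re, Complex.natCast_re]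
      positivity
    have hz₂ : 0 < (z + ((2 * N : ℕ) : ℂ)).re := by
      simp only [Complex.add_re, Complex.natCast_re]
      positivity
    have conv : ∀ {f : ℝ → ℂ}, LocallyIntegrableOn f (Set.Ioi 0) → (∀ x, δ < x → f x = 0) →
        (∀ b : ℝ, 0 < b → f =O[𝓝[>] 0] (fun x : ℝ => x ^ (-b))) → ∀ w : ℂ, 0 < w.re →
        MellinConvergent f w := fun hf h h' w hw => by
      obtain ⟨b, hb0, hbw⟩ := exists_between hw
      exact (hasDerivAt_mellin_of_compactSupport hf h (h' b hb0) hbw).1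
    have c₀ : MellinConvergent (truncSeries δ a₀) z :=
      conv (locallyIntegrableOn_truncSeries s₀) (fun _ hx => truncSeries_of_lt hx)
        (fun _ => isBigO_truncSeries hδ s₀) z hz
    have c₁ : MellinConvergent (fun t : ℝ => (t : ℂ) ^ (N : ℂ) •
        (Real.log t • truncSeries δ a₁ t)) z :=
      MellinConvergent.cpow_smul.2 (conv
        (locallyIntegrableOn_log_smul (locallyIntegrableOn_truncSeries s₁))
        (fun _ hx => by simp [truncSeries_of_lt hx])
        (fun _ => isBigO_log_smul fun _ => isBigO_truncSeries hδ s₁) _ hz₁)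
    have c₂ : MellinConvergent (fun t : ℝ => (t : ℂ) ^ ((2 * N : ℕ) : ℂ) •
        (Real.log t • Real.log t • truncSeries δ a₂ t)) z :=
      MellinConvergent.cpow_smul.2 (conv
        (locallyIntegrableOn_log_smul
          (locallyIntegrableOn_log_smul (locallyIntegrableOn_truncSeries s₂)))
        (fun _ hx => by simp [truncSeries_of_lt hx])
        (fun _ => isBigO_log_smul fun _ => isBigO_log_smul fun _ =>
          isBigO_truncSeries hδ s₂) _ hz₂)
    have h01 := hasMellin_add c₀ c₁
    have h012 := hasMellin_add h01.1 c₂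
    have h := hasMellin_add h012.1 (hEan z).1
    have e : mellin g z = mellin (fun t => truncSeries δ a₀ t + (t : ℂ) ^ (N : ℂ) •
        (Real.log t • truncSeries δ a₁ t) + (t : ℂ) ^ ((2 * N : ℕ) : ℂ) •
        (Real.log t • Real.log t • truncSeries δ a₂ t) + Set.indicator (Set.Ioi δ) g t) z := by
      refine setIntegral_congr_fun measurableSet_Ioi fun x hx => ?_
      have hx0 : 0 < x := hx
      simp only
      congr 1
      rcases le_or_gt x δ with hxδ | hxδ
      · have hmem : x ∈ Set.Ioc 0 δ := ⟨hx0, hxδ⟩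
        have hg' : g x = _ := hexp ⟨hx0, hxδ.trans_lt hδr'⟩
        have hns : x ∉ Set.Ioi δ := not_lt.2 hxδ
        rw [hg', Set.indicator_of_notMem hns, truncSeries,
          truncSeries, truncSeries, Set.indicator_of_mem hmem, Set.indicator_of_mem hmem,
          Set.indicator_of_mem hmem, e₀ x hx0.le hxδ, e₁ x hx0.le hxδ, e₂ x hx0.le hxδ,
          Complex.cpow_natCast, Complex.cpow_natCast]
        simp only [Complex.real_smul, smul_eq_mul, add_zero]
      · simp [truncSeries_of_lt hxδ, Set.indicator_of_mem (Set.mem_Ioi.2 hxδ)]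
    rw [e, h.2, h012.2, h01.2, mellin_cpow_smul, mellin_cpow_smul, mellin_truncSeries hδ s₀ hz,
      mellin_log_truncSeries hδ s₁ hz₁, mellin_log_log_truncSeries hδ s₂ hz₂]
  · have t₀ : Tendsto (fun z : ℂ => (z + N) ^ 2 * G₀ z) (𝓝[≠] (-(N : ℂ))) (𝓝 0) := by
      have := tendsto_sq_mul_of_tendsto_mul (F := G₀) (z₀ := -(N : ℂ)) (ρ := a₀ N)
        (by simpa using tendsto_mellinSeries hδ N s₀)
      simpa using this
    have t₁ : Tendsto (fun z : ℂ => (z + N) ^ 2 * deriv G₁ (z + N)) (𝓝[≠] (-(N : ℂ)))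
        (𝓝 (-A₁ 0)) := by
      have h1 := tendsto_sq_mul_deriv (F := G₁) (z₀ := 0) (ρ := A₁ 0) (hm₁ 0) (by
        have := tendsto_mellinSeries hδ 0 s₁
        simpa [ha₁0] using this)
      have h2 := tendsto_add_const_nhdsNE N (-(N : ℂ))
      rw [neg_add_cancel] at h2
      have := h1.comp h2
      simpa [Function.comp_def] using this
    -- At z = -N the log² term is evaluated at z + 2N = N > 0, where its series is analytic.
    have hc : ContinuousAt (fun z : ℂ => (z + N) ^ 2 *
        (deriv (deriv G₂) (z + (2 * N : ℕ)) + E z)) (-(N : ℂ)) := by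
      have hp : 0 < (-(N : ℂ) + ((2 * N : ℕ) : ℂ)).re := by
        have : (0 : ℝ) < N := by exact_mod_cast hN
        simp only [Complex.add_re, Complex.natCast_re, Complex.neg_re]
        push_cast
        linarith
      refine ContinuousAt.mul (by fun_prop) (ContinuousAt.add ?_ (hEan _).2.continuousAt)
      exact ContinuousAt.comp (f := fun z : ℂ => z + (2 * N : ℕ))
        (analyticAt_mellinSeries hδ s₂ hp).deriv.deriv.continuousAt (by fun_prop)
    have t₂ := hc.tendsto.mono_left (nhdsWithin_le_nhds (s := {(-(N : ℂ))}ᶜ))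
    have := (t₀.add t₁).add t₂
    simp only [neg_add_cancel, zero_add, ne_eq, OfNat.ofNat_ne_zero, not_false_eq_true, zero_pow,
      zero_mul, add_zero] at this
    refine this.congr fun z => ?_
    ring

/-! ### The integral as a Mellin transform -/

/-- The real weight `(1-x)^(m+n/2-1) S_m(1-x)²`, written through Euler's integral. -/
noncomputable def radialWeight (n m : ℕ) (x : ℝ) : ℝ :=
  (1 - x) ^ ((m : ℝ) + (n : ℝ) / 2 - 1) * (residueConst n m * eulerIntegral m (n / 2) (1 - x)) ^ 2

theorem continuous_radialWeight {n m : ℕ} (hn : 2 < n) : Continuous (radialWeight n m) := by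
  have hn' : (2 : ℝ) < n := by exact_mod_cast hn
  have hm' : (0 : ℝ) ≤ m := by positivity
  refine Continuous.mul ?_ ((continuous_const.mul
    ((continuous_eulerIntegral m (by linarith)).comp (by fun_prop))).pow 2)
  exact (by fun_prop : Continuous fun x : ℝ => 1 - x).rpow_const fun _ => Or.inr (by linarith)

theorem coeffIntegrand_eq {n m : ℕ} (hn : 2 < n) (hm : 0 < m) (s : ℂ) {t : ℝ} (ht0 : 0 ≤ t)
    (ht : t < 1) :
    coeffIntegrand n m s t = ((1 - t : ℝ) : ℂ) ^ s * (radialWeight n m (1 - t) : ℂ) := by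
  rw [coeffIntegrand, radialFactor_eq hn hm ht0 ht, radialWeight, sub_sub_cancel]
  push_cast
  ring

theorem ae_coeffIntegrand_eq {n m : ℕ} (hn : 2 < n) (hm : 0 < m) (s : ℂ) :
    ∀ᵐ t : ℝ, t ∈ Set.uIoc (0 : ℝ) 1 →
      coeffIntegrand n m s t = ((1 - t : ℝ) : ℂ) ^ s * (radialWeight n m (1 - t) : ℂ) := by
  -- Euler's formula for the radial factor is available only for t < 1; the endpoint is a null set.
  have h : ∀ᵐ t : ℝ, t ≠ 1 := by simp [ae_iff, measure_singleton]
  filter_upwards [h] with t ht1 ht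
  rw [Set.uIoc_of_le zero_le_one] at ht
  exact coeffIntegrand_eq hn hm s ht.1.le (lt_of_le_of_ne ht.2 ht1)

theorem intervalIntegrable_coeffIntegrand {n m : ℕ} (hn : 2 < n) (hm : 0 < m) {s : ℂ}
    (hs : -1 < s.re) : IntervalIntegrable (coeffIntegrand n m s) volume (0 : ℝ) 1 := by
  have h1 : IntervalIntegrable (fun x : ℝ => (x : ℂ) ^ s * (radialWeight n m x : ℂ)) volume 1 0 :=
    (intervalIntegral.intervalIntegrable_cpow' hs).mul_continuousOn
      (Complex.continuous_ofReal.comp (continuous_radialWeight hn)).continuousOn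
  have h2 := h1.comp_sub_left 1
  simp only [sub_self, sub_zero] at h2
  refine h2.congr_ae ?_
  have := ae_coeffIntegrand_eq hn hm s
  rw [Filter.EventuallyEq, ae_restrict_iff' measurableSet_uIoc]
  filter_upwards [this] with t ht h
  exact (ht h).symm

/-- The weight, cut off to `(0, 1]`. -/
noncomputable def cutRadialWeight (n m : ℕ) : ℝ → ℂ :=
  Set.indicator (Set.Ioc 0 1) fun x => (radialWeight n m x : ℂ)

theorem integral_coeffIntegrand {n m : ℕ} (hn : 2 < n) (hm : 0 < m) (s : ℂ) :
    ∫ t in (0 : ℝ)..1, coeffIntegrand n m s t = mellin (cutRadialWeight n m) (s + 1) := by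
  rw [intervalIntegral.integral_congr_ae (ae_coeffIntegrand_eq hn hm s),
    intervalIntegral.integral_comp_sub_left
      (fun x : ℝ => (x : ℂ) ^ s * (radialWeight n m x : ℂ)) 1, sub_self, sub_zero, mellin]
  simp_rw [cutRadialWeight, ← Set.indicator_smul]
  rw [integral_indicator measurableSet_Ioc, intervalIntegral.integral_of_le zero_le_one,
    Measure.restrict_restrict_of_subset Set.Ioc_subset_Ioi_self]
  simp

theorem locallyIntegrableOn_cutRadialWeight {n m : ℕ} (hn : 2 < n) :
    LocallyIntegrableOn (cutRadialWeight n m) (Set.Ioi 0) := by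
  refine LocallyIntegrable.locallyIntegrableOn ?_ _
  refine LocallyIntegrable.indicator ?_ measurableSet_Ioc
  exact (Complex.continuous_ofReal.comp (continuous_radialWeight hn)).locallyIntegrable

/-! ### The Gamma factor near s = -n -/

/-- The Gamma factor in front of the integral. -/
noncomputable def gammaFactor (n : ℕ) (s : ℂ) : ℂ :=
  Complex.Gamma ((n : ℂ) / 2 + s + 1) / (Complex.Gamma ((n : ℂ) / 2) * Complex.Gamma (s + 1))

theorem meromorphic_gammaFactor (n : ℕ) : Meromorphic (gammaFactor n) := by
  have h1 : Meromorphic fun s : ℂ => Complex.Gamma ((n : ℂ) / 2 + s + 1) := by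
    have := Meromorphic.meromorphic_fun_comp_add_const_iff_meromorphic (c := (n : ℂ) / 2 + 1).2
      Meromorphic.Gamma
    simpa only [add_assoc, add_comm, add_left_comm] using this
  have h2 : Meromorphic fun s : ℂ => Complex.Gamma (s + 1) :=
    Meromorphic.meromorphic_fun_comp_add_const_iff_meromorphic.2 Meromorphic.Gamma
  exact h1.div ((Meromorphic.const _).mul h2)

theorem ascPochhammer_eval_one_sub_natCast (n k : ℕ) (hn : 0 < n) :
    (ascPochhammer ℂ k).eval (1 - (n : ℂ)) = (-1) ^ k * ((n - 1).descFactorial k : ℂ) := by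
  rw [show (1 - (n : ℂ)) = -((n - 1 : ℕ) : ℂ) by rw [Nat.cast_sub hn]; push_cast; ring,
    ascPochhammer_eval_neg_eq_descPochhammer, descPochhammer_eval_eq_descFactorial]

theorem eventually_ne_neg_natCast (n : ℕ) :
    ∀ᶠ s : ℂ in 𝓝[≠] (-(n : ℂ)), ∀ k : ℕ, s + 1 ≠ -k := by
  filter_upwards [self_mem_nhdsWithin, mem_nhdsWithin_of_mem_nhds (Metric.ball_mem_nhds _ one_pos)]
    with s hs hb k hk
  refine hs ?_
  rw [Set.mem_singleton_iff]
  rw [mem_ball_iff_norm, sub_neg_eq_add, eq_sub_of_add_eq hk] at hb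
  have e : (-(k : ℂ) - 1 + n) = (((n : ℤ) - k - 1 : ℤ) : ℂ) := by push_cast; ring
  rw [e, Complex.norm_intCast] at hb
  have h1 : |(n : ℤ) - k - 1| < 1 := by exact_mod_cast hb
  have h2 : (n : ℤ) - k - 1 = 0 := Int.abs_lt_one_iff.1 h1
  rw [eq_sub_of_add_eq hk]
  have h3 : n = k + 1 := by omega
  rw [h3]
  push_cast
  ring

theorem tendsto_ascPochhammer (n k : ℕ) (hn : 0 < n) :
    Tendsto (fun s : ℂ => (ascPochhammer ℂ k).eval (s + 1)) (𝓝[≠] (-(n : ℂ)))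
      (𝓝 ((-1) ^ k * ((n - 1).descFactorial k : ℂ))) := by
  have hc : ContinuousAt (fun s : ℂ => (ascPochhammer ℂ k).eval (s + 1)) (-(n : ℂ)) :=
    ((ascPochhammer ℂ k).continuous.comp (by fun_prop : Continuous fun s : ℂ => s + 1)).continuousAt
  have := hc.tendsto.mono_left (nhdsWithin_le_nhds (s := {(-(n : ℂ))}ᶜ))
  rwa [neg_add_eq_sub, ascPochhammer_eval_one_sub_natCast n k hn] at this

/-- For integral h the quotient Γ(h+s+1)/Γ(s+1) is the polynomial (s+1)_h, so the poles cancel. -/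
theorem tendsto_gammaFactor_even {h : ℕ} (hh : 0 < h) :
    Tendsto (gammaFactor (2 * h)) (𝓝[≠] (-((2 * h : ℕ) : ℂ)))
      (𝓝 ((-1) ^ h * ((2 * h - 1).descFactorial h : ℂ) / Complex.Gamma h)) := by
  refine ((tendsto_ascPochhammer (2 * h) h (by omega)).div_const _).congr' ?_
  filter_upwards [eventually_ne_neg_natCast (2 * h)] with s hs
  rw [← Complex.Gamma_add_nat_div_Gamma_eq _ hs, gammaFactor, div_div,
    show ((2 * h : ℕ) : ℂ) / 2 = h by push_cast; ring, add_right_comm, add_comm (h : ℂ),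
    add_right_comm, mul_comm (Complex.Gamma (s + 1)), add_right_comm]

theorem one_sub_half_ne_neg_natCast {n : ℕ} (hn : Odd n) (k : ℕ) : 1 - (n : ℂ) / 2 ≠ -k := by
  intro h
  have h2 : (n : ℂ) = ((2 * (k + 1) : ℕ) : ℂ) := by
    push_cast
    linear_combination (-2) * h
  rw [Nat.cast_inj] at h2
  exact (Nat.not_even_iff_odd.2 hn) (h2 ▸ even_two_mul _)

/-- The numerator is finite because 1 - n/2 is a half-integer. The zero comes from 1/Γ(s+1) =
(s+1)_(n-1) (s+n) / Γ(s+1+n), whose last Gamma value tends to Γ(1) = 1. -/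
theorem tendsto_gammaFactor_odd {n : ℕ} (hn : Odd n) :
    Tendsto (fun s => gammaFactor n s / (s + n)) (𝓝[≠] (-(n : ℂ)))
      (𝓝 (Complex.Gamma (1 - (n : ℂ) / 2) / Complex.Gamma ((n : ℂ) / 2) *
        ((n - 1).factorial : ℂ))) := by
  have hpos := hn.pos
  have c₁ : ContinuousAt (fun s : ℂ => Complex.Gamma ((n : ℂ) / 2 + s + 1) /
      Complex.Gamma ((n : ℂ) / 2)) (-(n : ℂ)) := by
    refine ContinuousAt.div_const (ContinuousAt.comp (f := fun s : ℂ => (n : ℂ) / 2 + s + 1)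
      (Complex.differentiableAt_Gamma _ fun k => ?_).continuousAt (by fun_prop)) _
    convert one_sub_half_ne_neg_natCast hn k using 1
    ring
  have c₂ : ContinuousAt (fun s : ℂ => (Complex.Gamma (s + 1 + n))⁻¹) (-(n : ℂ)) :=
    (Complex.differentiable_one_div_Gamma.continuous.comp
      (by fun_prop : Continuous fun s : ℂ => s + 1 + n)).continuousAt
  have t₁ := c₁.tendsto.mono_left (nhdsWithin_le_nhds (s := {(-(n : ℂ))}ᶜ))
  have t₂ := c₂.tendsto.mono_left (nhdsWithin_le_nhds (s := {(-(n : ℂ))}ᶜ))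
  have t := t₁.mul ((tendsto_ascPochhammer n (n - 1) hpos).mul t₂)
  rw [show (n : ℂ) / 2 + -n + 1 = 1 - n / 2 by ring, show -(n : ℂ) + 1 + n = 1 by ring,
    Complex.Gamma_one, inv_one, mul_one, (hn.tsub_odd odd_one).neg_one_pow, one_mul,
    Nat.descFactorial_self] at t
  refine t.congr' ?_
  filter_upwards [eventually_ne_neg_natCast n, self_mem_nhdsWithin] with s hs hsn
  have hsn' : s + n ≠ 0 := fun h => hsn (eq_neg_of_add_eq_zero_left h)
  have g : Complex.Gamma (s + 1) ≠ 0 := Complex.Gamma_ne_zero hs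
  have g2 : Complex.Gamma (s + 1 + n) ≠ 0 := Complex.Gamma_ne_zero fun k hk =>
    hs (k + n) (by push_cast; linear_combination hk)
  have e := Complex.Gamma_add_nat_div_Gamma_eq (n := n - 1 + 1) _ hs
  rw [ascPochhammer_succ_eval, Nat.sub_add_cancel hpos, div_eq_iff g] at e
  have e' : s + 1 + ((n - 1 : ℕ) : ℂ) = s + n := by
    rw [Nat.cast_sub hpos]
    push_cast
    ring
  rw [e'] at e
  rw [gammaFactor, e, ← div_div, div_div, div_eq_mul_inv _ (_ * _)]
  congr 1
  rw [← div_eq_mul_inv, div_eq_iff (by rw [← e]; exact g2)]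
  field_simp

/-- A nonzero limit means that (s - z) f has order 0, and orders add under products. -/
theorem hasSimplePoleWithResidue_of_tendsto {f : ℂ → ℂ} {z r : ℂ} (hf : MeromorphicAt f z)
    (hr : r ≠ 0) (h : Tendsto (fun s => (s - z) * f s) (𝓝[≠] z) (𝓝 r)) :
    HasSimplePoleWithResidue f z r := by
  refine ⟨?_, h⟩
  have hz : MeromorphicAt (fun s : ℂ => s - z) z := (MeromorphicAt.id _).sub (MeromorphicAt.const _ _)
  have h0 : meromorphicOrderAt (fun s => (s - z) * f s) z = 0 :=
    (tendsto_ne_zero_iff_meromorphicOrderAt_eq_zero (hz.mul hf)).1 ⟨r, hr, h⟩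
  have h1 : meromorphicOrderAt (fun s : ℂ => s - z) z = 1 := meromorphicOrderAt_id_sub_const
  rw [fun_meromorphicOrderAt_mul hz hf, h1] at h0
  have h2 : meromorphicOrderAt f z ≠ ⊤ := fun h => by simp [h] at h0
  lift meromorphicOrderAt f z to ℤ using h2 with k
  have h3 : 1 + k = 0 := by exact_mod_cast h0
  rw [show k = -1 by omega]
  rfl

/-! ### Substitution in Euler's integral; even dimension -/

/-- Euler's integral after the substitution `w = t u`. -/
theorem rpow_mul_eulerIntegral (m : ℕ) (hm : 0 < m) {h t : ℝ} (ht0 : 0 < t) :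
    t ^ ((m : ℝ) + h - 1) * eulerIntegral m h t =
      ∫ w in (0 : ℝ)..t, w ^ (m - 1) * (t - w) ^ (h - 1) * (1 - w) ^ (h - 1) := by
  have h1 := intervalIntegral.smul_integral_comp_mul_left (a := 0) (b := 1)
    (fun w : ℝ => w ^ (m - 1) * (t - w) ^ (h - 1) * (1 - w) ^ (h - 1)) t
  rw [mul_zero, mul_one] at h1
  rw [← h1, smul_eq_mul, eulerIntegral, ← intervalIntegral.integral_const_mul,
    ← intervalIntegral.integral_const_mul]
  refine intervalIntegral.integral_congr fun u hu => ?_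
  rw [Set.uIcc_of_le zero_le_one] at hu
  have e : t ^ ((m : ℝ) + h - 1) = t * t ^ (m - 1) * t ^ (h - 1) := by
    rw [← pow_succ', Nat.sub_add_cancel hm, ← Real.rpow_natCast, ← Real.rpow_add ht0]
    ring_nf
  rw [show t - t * u = t * (1 - u) by ring, Real.mul_rpow ht0.le (sub_nonneg.2 hu.2), mul_pow, e]
  ring

/-- An integral of `d`-th powers of affine functions of `x` is a polynomial in `x`. -/
theorem exists_polynomial_integral {w α β : ℝ → ℝ} (hw : Continuous w) (hα : Continuous α)
    (hβ : Continuous β) (d : ℕ) : ∃ P : Polynomial ℝ, P.natDegree ≤ d ∧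
      ∀ x : ℝ, P.eval x = ∫ u in (0 : ℝ)..1, w u * (α u + x * β u) ^ d := by
  refine ⟨∑ i ∈ Finset.range (d + 1), Polynomial.C (∫ u in (0 : ℝ)..1,
    w u * (β u ^ i * α u ^ (d - i) * d.choose i)) * Polynomial.X ^ i, ?_, fun x => ?_⟩
  · refine Polynomial.natDegree_sum_le_of_forall_le _ _ fun i hi => ?_
    exact (Polynomial.natDegree_C_mul_X_pow_le _ _).trans (Finset.mem_range_succ_iff.1 hi)
  · have e : ∀ u, w u * (α u + x * β u) ^ d = ∑ i ∈ Finset.range (d + 1),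
        w u * (β u ^ i * α u ^ (d - i) * d.choose i) * x ^ i := fun u => by
      rw [add_comm, add_pow, Finset.mul_sum]
      refine Finset.sum_congr rfl fun i _ => ?_
      ring
    simp_rw [e]
    rw [intervalIntegral.integral_finsetSum fun i _ =>
      (by fun_prop : Continuous _).intervalIntegrable _ _, Polynomial.eval_finsetSum]
    refine Finset.sum_congr rfl fun i _ => ?_
    rw [intervalIntegral.integral_mul_const]
    simp

section EvenDimension

variable {m h : ℕ}

theorem eulerIntegral_natCast (m : ℕ) (hh : 0 < h) (t : ℝ) : eulerIntegral m h t =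
    ∫ u in (0 : ℝ)..1, u ^ (m - 1) * (1 - u) ^ (h - 1) * (1 - t * u) ^ (h - 1) := by
  have e : (h : ℝ) - 1 = ((h - 1 : ℕ) : ℝ) := by rw [Nat.cast_sub hh, Nat.cast_one]
  simp only [eulerIntegral, e, Real.rpow_natCast]

/-- Put w = 1 - x + xy: then 1 - x - w = -xy, 1 - w = x(1-y) and dw = x dy, which together produce
x^(2h-1) and the sign (-1)^(h-1). -/
theorem integral_reflected_piece (m : ℕ) (hh : 0 < h) (x : ℝ) :
    ∫ w in (1 - x)..1, w ^ (m - 1) * (1 - x - w) ^ (h - 1) * (1 - w) ^ (h - 1) =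
      -((-1) ^ h * x ^ (2 * h - 1) * ∫ y in (0 : ℝ)..1,
        y ^ (h - 1) * (1 - y) ^ (h - 1) * (1 + x * (y - 1)) ^ (m - 1)) := by
  have h1 := intervalIntegral.smul_integral_comp_add_mul (a := 0) (b := 1)
    (fun w : ℝ => w ^ (m - 1) * (1 - x - w) ^ (h - 1) * (1 - w) ^ (h - 1)) x (1 - x)
  rw [mul_zero, mul_one, add_zero, sub_add_cancel] at h1
  rw [← h1, smul_eq_mul, ← intervalIntegral.integral_const_mul,
    ← intervalIntegral.integral_const_mul, ← intervalIntegral.integral_neg]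
  congr 1 with y
  obtain ⟨k, rfl⟩ := Nat.exists_eq_succ_of_ne_zero hh.ne'
  rw [show 2 * k.succ - 1 = 1 + k + k by omega, show k.succ - 1 = k by omega,
    show 1 - x - (1 - x + x * y) = (-1) * (x * y) by ring,
    show 1 - (1 - x + x * y) = x * (1 - y) by ring, mul_pow, mul_pow, mul_pow, pow_add, pow_add,
    pow_succ, show 1 - x + x * y = 1 + x * (y - 1) by ring]
  ring

/-- In even dimension the weight is a polynomial whose coefficient at `x^(n-1)` is explicit. -/
theorem exists_polynomial_radialWeight (hm : 0 < m) (hh : 1 < h) :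
    ∃ p : Polynomial ℝ, (∀ x : ℝ, 0 < x → x ≤ 1 → radialWeight (2 * h) m x = p.eval x) ∧
      p.coeff (2 * h - 1) = residueConst (2 * h) m *
        ((-1) ^ h * (Real.Gamma h * Real.Gamma h / Real.Gamma (2 * h))) := by
  have hh0 : 0 < h := by omega
  -- P is J(1-x), through 1 - (1-x)u = (1-u) + xu. P' is the integral of the substituted form over
  -- all of [0,1], and Q belongs to the piece over [1-x, 1].
  obtain ⟨P, hPd, hP⟩ := exists_polynomial_integral
    (w := fun u => u ^ (m - 1) * (1 - u) ^ (h - 1)) (α := fun u => 1 - u) (β := fun u => u)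
    (by fun_prop) (by fun_prop) (by fun_prop) (h - 1)
  obtain ⟨P', hPd', hP'⟩ := exists_polynomial_integral
    (w := fun u => u ^ (m - 1) * (1 - u) ^ (h - 1)) (α := fun u => 1 - u) (β := fun _ => -1)
    (by fun_prop) (by fun_prop) (by fun_prop) (h - 1)
  obtain ⟨Q, -, hQ⟩ := exists_polynomial_integral
    (w := fun y => y ^ (h - 1) * (1 - y) ^ (h - 1)) (α := fun _ => 1) (β := fun y => y - 1)
    (by fun_prop) (by fun_prop) (by fun_prop) (m - 1)
  have hcast : ((2 * h : ℕ) : ℝ) / 2 = h := by push_cast; ring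
  have hJ : ∀ x, eulerIntegral m h (1 - x) = P.eval x := fun x => by
    rw [hP, eulerIntegral_natCast m hh0]
    congr 1 with u
    ring
  have hW : ∀ x : ℝ, x ≤ 1 → (1 - x) ^ (m + h - 1) * eulerIntegral m h (1 - x) =
      P'.eval x + (-1) ^ h * x ^ (2 * h - 1) * Q.eval x := fun x hx => by
    -- The substitution w = tu needs t = 1 - x > 0, so x = 1 is treated apart.
    rcases hx.eq_or_lt with rfl | hx
    · have e1 := integral_reflected_piece m hh0 1
      rw [← hQ, eq_neg_iff_add_eq_zero] at e1
      rw [sub_self, zero_pow (by omega), zero_mul, ← e1, hP', sub_self]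
      congr 2 with u
      ring
    have e := rpow_mul_eulerIntegral m hm (h := h) (t := 1 - x) (by linarith)
    rw [show (m : ℝ) + h - 1 = ((m + h - 1 : ℕ) : ℝ) by
      rw [Nat.cast_sub (by omega)]; push_cast; ring, Real.rpow_natCast,
      show (h : ℝ) - 1 = ((h - 1 : ℕ) : ℝ) by rw [Nat.cast_sub hh0, Nat.cast_one]] at e
    simp only [Real.rpow_natCast] at e
    have hc : Continuous fun w : ℝ => w ^ (m - 1) * (1 - x - w) ^ (h - 1) * (1 - w) ^ (h - 1) := by
      fun_prop
    have e2 := integral_reflected_piece m hh0 x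
    rw [← hQ] at e2
    have e3 := intervalIntegral.integral_add_adjacent_intervals (hc.intervalIntegrable 0 (1 - x))
      (hc.intervalIntegrable (μ := volume) (1 - x) 1)
    rw [e, eq_sub_of_add_eq e3, e2, sub_neg_eq_add, hP']
    congr 2 with u
    ring
  have hP0 : residueConst (2 * h) m * P.eval 0 = 1 := by
    have := residueConst_mul_eulerIntegral_one (n := 2 * h) (m := m) (by omega) hm
    rwa [hcast, show (1 : ℝ) = 1 - 0 by ring, hJ, sub_zero] at this
  have hQ0 : Q.eval 0 = Real.Gamma h * Real.Gamma h / Real.Gamma (2 * h) := by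
    have := integral_pow_mul_one_sub_rpow (h - 1) (b := h) (by exact_mod_cast hh0)
    rw [show ((h - 1 : ℕ) : ℝ) + 1 = h by rw [Nat.cast_sub hh0]; push_cast; ring, ← two_mul,
      show (h : ℝ) - 1 = ((h - 1 : ℕ) : ℝ) by rw [Nat.cast_sub hh0, Nat.cast_one]] at this
    simp only [Real.rpow_natCast] at this
    rw [hQ, ← this]
    simp
  set K := residueConst (2 * h) m
  refine ⟨Polynomial.C (K ^ 2) * (P * P' + Polynomial.X ^ (2 * h - 1) *
    (Polynomial.C ((-1) ^ h) * Q * P)), fun x hx0 hx => ?_, ?_⟩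
  · have e : (m : ℝ) + ((2 * h : ℕ) : ℝ) / 2 - 1 = ((m + h - 1 : ℕ) : ℝ) := by
      rw [hcast, Nat.cast_sub (by omega)]
      push_cast
      ring
    rw [radialWeight, e, Real.rpow_natCast, hcast]
    have := hW x hx
    rw [hJ] at this ⊢
    simp only [Polynomial.eval_mul, Polynomial.eval_add, Polynomial.eval_C, Polynomial.eval_pow,
      Polynomial.eval_X]
    linear_combination K ^ 2 * P.eval x * this
  -- The degree is at most 2(h-1), just below 2h - 1.
  · have hdeg : (P * P').coeff (2 * h - 1) = 0 := by
      refine Polynomial.coeff_eq_zero_of_natDegree_lt ?_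
      have := Polynomial.natDegree_mul_le (p := P) (q := P')
      omega
    rw [Polynomial.coeff_C_mul, Polynomial.coeff_add, hdeg, Polynomial.coeff_X_pow_mul', if_pos le_rfl,
      Nat.sub_self, Polynomial.coeff_zero_eq_eval_zero, Polynomial.eval_mul, Polynomial.eval_mul,
      Polynomial.eval_C, hQ0]
    linear_combination K * (-1) ^ h * (Real.Gamma h * Real.Gamma h / Real.Gamma (2 * h)) * hP0

end EvenDimension

theorem coeffI_eq {n m : ℕ} (hn : 2 < n) (hm : 0 < m) (s : ℂ) :
    coeffI n m s = gammaFactor n s * mellin (cutRadialWeight n m) (s + 1) := by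
  rw [coeffI, integral_coeffIntegrand hn hm, gammaFactor]

theorem exists_continuation_even {n m : ℕ} (hn : 2 < n) (hm : 0 < m) (he : Even n) :
    ∃ F : ℂ → ℂ, Meromorphic F ∧ (∀ s : ℂ, -1 < s.re → F s = coeffI n m s) ∧
      HasSimplePoleWithResidue F (-(n : ℂ)) (residueConst n m : ℂ) := by
  obtain ⟨h, rfl⟩ := he.two_dvd
  obtain ⟨p, hp, hcoeff⟩ := exists_polynomial_radialWeight (m := m) (h := h) hm (by omega)
  -- The weight is polynomial on all of (0,1], so the cut δ = 1 is exact and leaves no remainder.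
  set a : ℕ → ℂ := fun k => (p.coeff k : ℂ) with ha
  have hfin : ∀ k, k ∉ Finset.range (p.natDegree + 1) → p.coeff k = 0 := fun k hk =>
    Polynomial.coeff_eq_zero_of_natDegree_lt (by simpa using hk)
  have hsum : Summable fun k => ‖a k‖ * (1 : ℝ) ^ k :=
    summable_of_ne_finset_zero (s := Finset.range (p.natDegree + 1)) fun k hk => by
      simp [ha, hfin k hk]
  have hmellin : ∀ z : ℂ, 0 < z.re → mellin (cutRadialWeight (2 * h) m) z = mellinSeries 1 a z := by
    intro z hz
    rw [← mellin_indicator_powerSeries one_pos hsum hz, cutRadialWeight]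
    congr 1
    refine Set.indicator_congr fun x hx => ?_
    rw [hp x hx.1 hx.2, tsum_eq_sum (s := Finset.range (p.natDegree + 1)) fun k hk => by
      simp [ha, hfin k hk], Polynomial.eval_eq_sum_range]
    push_cast
    rfl
  have hF : Meromorphic fun s => gammaFactor (2 * h) s * mellinSeries 1 a (s + 1) :=
    (meromorphic_gammaFactor _).mul
      (Meromorphic.meromorphic_fun_comp_add_const_iff_meromorphic.2
        (meromorphic_mellinSeries one_pos hsum))
  refine ⟨_, hF, fun s hs => ?_, ?_⟩
  · rw [coeffI_eq hn hm, hmellin (s + 1) (by simpa using by linarith)]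
  · refine hasSimplePoleWithResidue_of_tendsto (hF _)
      (by exact_mod_cast (residueConst_pos hn hm).ne') ?_
    have t₁ := tendsto_mellinSeries one_pos (2 * h - 1) hsum
    have t₂ := tendsto_add_const_nhdsNE 1 (-((2 * h : ℕ) : ℂ))
    have e : -((2 * h : ℕ) : ℂ) + 1 = -((2 * h - 1 : ℕ) : ℂ) := by
      rw [Nat.cast_sub (by omega)]
      push_cast
      ring
    rw [e] at t₂
    have t := (tendsto_gammaFactor_even (h := h) (by omega)).mul (t₁.comp t₂)
    -- The limit of the Gamma factor cancels B(h,h) = (h-1)!²/(2h-1)!, and the two signs (-1)^h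
    -- cancel each other.
    have hval : (-1 : ℂ) ^ h * ((2 * h - 1).descFactorial h : ℂ) / Complex.Gamma h *
        a (2 * h - 1) = (residueConst (2 * h) m : ℂ) := by
      obtain ⟨k, rfl⟩ := Nat.exists_eq_succ_of_ne_zero (show h ≠ 0 by omega)
      have e1 : k.factorial * (2 * k.succ - 1).descFactorial k.succ = (2 * k.succ - 1).factorial := by
        have := Nat.factorial_mul_descFactorial (show k.succ ≤ 2 * k.succ - 1 by omega)
        rwa [show 2 * k.succ - 1 - k.succ = k by omega] at this
      have e2 : (k.factorial : ℂ) * ((2 * k.succ - 1).descFactorial k.succ : ℂ) =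
          ((2 * k.succ - 1).factorial : ℂ) := by exact_mod_cast e1
      have g1 : Real.Gamma (k.succ : ℝ) = k.factorial := by
        rw [Nat.succ_eq_add_one, Nat.cast_succ, Real.Gamma_nat_eq_factorial]
      have g2 : Real.Gamma (2 * (k.succ : ℝ)) = (2 * k.succ - 1).factorial := by
        rw [show 2 * (k.succ : ℝ) = ((2 * k.succ - 1 : ℕ) : ℝ) + 1 by
          rw [Nat.cast_sub (by omega)]; push_cast; ring, Real.Gamma_nat_eq_factorial]
      have g3 : Complex.Gamma (k.succ : ℂ) = k.factorial := by
        rw [Nat.succ_eq_add_one, Nat.cast_succ, Complex.Gamma_nat_eq_factorial]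
      have f1 : (k.factorial : ℂ) ≠ 0 := by exact_mod_cast k.factorial_ne_zero
      have f2 : ((2 * k.succ - 1).factorial : ℂ) ≠ 0 := by exact_mod_cast Nat.factorial_ne_zero _
      have hsq : ((-1 : ℂ) ^ k.succ) * (-1) ^ k.succ = 1 := by
        rw [← mul_pow]
        simp
      simp only [ha]
      rw [hcoeff, g1, g2, g3]
      push_cast
      rw [← e2] at f2 ⊢
      have f3 := right_ne_zero_of_mul f2
      field_simp
      linear_combination (residueConst (2 * k.succ) m : ℂ) * hsq
    rw [hval] at t
    refine t.congr fun s => ?_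
    rw [Function.comp_apply, Nat.cast_sub (by omega)]
    push_cast
    ring

/-! ### Odd dimension: integrals with half-integer exponents -/

theorem analyticAt_one_sub_rpow (c : ℝ) : AnalyticAt ℝ (fun x : ℝ => (1 - x) ^ c) 0 := by
  have h1 : AnalyticAt ℝ (fun x : ℝ => 1 - x) 0 := by fun_prop
  have h2 : AnalyticAt ℝ (fun x : ℝ => Real.exp (Real.log (1 - x) * c)) 0 :=
    ((h1.log (by norm_num)).mul analyticAt_const).rexp'
  refine h2.congr ?_
  filter_upwards [Iio_mem_nhds (show (0 : ℝ) < 1 by norm_num)] with x hx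
  rw [Real.rpow_def_of_pos (sub_pos.2 hx)]

/-- Coefficient of `x^(a+b) log x` in `∫₀^{1-x} w^(a-1/2) (x+w)^(b-1/2) dw`. -/
noncomputable def logCoeff (a b : ℕ) : ℝ :=
  -(Real.Gamma (b + 1 / 2) / ((a + b).factorial * Real.Gamma (1 / 2 - a)))

theorem half_sub_ne_neg_natCast (a k : ℕ) : (1 / 2 - a : ℝ) ≠ -k := by
  intro h
  have : (1 : ℤ) + 2 * k = 2 * a := by
    have h' : (1 : ℝ) + 2 * k = 2 * a := by linarith
    exact_mod_cast h'
  omega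

theorem Gamma_half_sub_ne_zero (a : ℕ) : Real.Gamma (1 / 2 - a) ≠ 0 :=
  Real.Gamma_ne_zero (half_sub_ne_neg_natCast a)

theorem Gamma_half_sub_eq (a : ℕ) :
    Real.Gamma (1 / 2 - a) = (-1 / 2 - a) * Real.Gamma (1 / 2 - (a + 1 : ℕ)) := by
  have h : (1 / 2 - (a + 1 : ℕ) : ℝ) ≠ 0 := by simpa using half_sub_ne_neg_natCast (a + 1) 0
  rw [show (1 / 2 - a : ℝ) = 1 / 2 - (a + 1 : ℕ) + 1 by push_cast; ring, Real.Gamma_add_one h]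
  push_cast
  ring

theorem logCoeff_zero_zero : logCoeff 0 0 = -1 := by
  have : Real.Gamma (1 / 2) ≠ 0 := by simpa using Gamma_half_sub_ne_zero 0
  simp only [logCoeff, Nat.cast_zero, zero_add, Nat.factorial_zero, Nat.cast_one, one_mul, sub_zero]
  rw [div_self this]

theorem logCoeff_succ_zero (a : ℕ) :
    (a + 1) * logCoeff (a + 1) 0 = -((a + 1 / 2) * logCoeff a 0) := by
  have h1 := Gamma_half_sub_ne_zero (a + 1)
  have h2 := Gamma_half_sub_eq a
  have h3 : (-1 / 2 - a : ℝ) ≠ 0 := by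
    have : (0 : ℝ) ≤ a := by positivity
    linarith
  have h4 : ((a.factorial : ℕ) : ℝ) ≠ 0 := by exact_mod_cast a.factorial_ne_zero
  have h5 : (a + 1 : ℝ) ≠ 0 := by positivity
  simp only [logCoeff, add_zero, h2, Nat.factorial_succ]
  generalize Real.Gamma (1 / 2 - (a + 1 : ℕ)) = g at h1 ⊢
  rw [show (a + 1 / 2 : ℝ) = -(-1 / 2 - a) by ring]
  generalize (-1 / 2 - a : ℝ) = r at h3 ⊢
  push_cast
  field_simp

/-- Together with `logCoeff_succ_zero` this mirrors the recurrences of `halfIntegral`, which is how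
the closed form gets identified. -/
theorem logCoeff_succ (a b : ℕ) : logCoeff a (b + 1) = logCoeff a b + logCoeff (a + 1) b := by
  have h1 := Gamma_half_sub_ne_zero (a + 1)
  have h2 := Gamma_half_sub_eq a
  have h3 : (-1 / 2 - a : ℝ) ≠ 0 := by
    have : (0 : ℝ) ≤ a := by positivity
    linarith
  have h4 : (((a + b).factorial : ℕ) : ℝ) ≠ 0 := by exact_mod_cast (a + b).factorial_ne_zero
  have h5 : (a + b + 1 : ℝ) ≠ 0 := by positivity
  have h6 : (b + 1 / 2 : ℝ) ≠ 0 := by positivity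
  simp only [logCoeff, h2]
  rw [show a + (b + 1) = a + b + 1 by ring, show a + 1 + b = a + b + 1 by ring, Nat.factorial_succ,
    show ((b + 1 : ℕ) : ℝ) + 1 / 2 = b + 1 / 2 + 1 by push_cast; ring, Real.Gamma_add_one h6]
  generalize Real.Gamma (1 / 2 - (a + 1 : ℕ)) = g at h1 ⊢
  -- This splitting is the whole identity: its two summands give the two terms on the right.
  have h7 : (b + 1 / 2 : ℝ) = (a + b + 1) + (-1 / 2 - a) := by ring
  generalize Real.Gamma (b + 1 / 2) = G
  rw [h7]
  generalize (-1 / 2 - a : ℝ) = r at h3 ⊢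
  push_cast
  field_simp
  ring

/-- `∫₀^{1-x} w^(a-1/2) (x+w)^(b-1/2) dw`. -/
noncomputable def halfIntegral (a b : ℕ) (x : ℝ) : ℝ :=
  ∫ w in (0 : ℝ)..(1 - x), w ^ ((a : ℝ) - 1 / 2) * (x + w) ^ ((b : ℝ) - 1 / 2)

theorem intervalIntegrable_halfIntegral (a b : ℕ) {x : ℝ} (hx0 : 0 < x) (hx : x < 1) :
    IntervalIntegrable (fun w : ℝ => w ^ ((a : ℝ) - 1 / 2) * (x + w) ^ ((b : ℝ) - 1 / 2))
      volume 0 (1 - x) := by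
  have ha : (0 : ℝ) ≤ a := by positivity
  refine (intervalIntegral.intervalIntegrable_rpow' (by linarith)).mul_continuousOn ?_
  refine ContinuousOn.rpow_const (by fun_prop) fun w hw => Or.inl ?_
  rw [Set.uIcc_of_le (by linarith)] at hw
  linarith [hw.1]

/-- The integrand has antiderivative 2 log(√w + √(x+w)); its value at w = 0 is log x, the source of
every logarithm. -/
theorem halfIntegral_zero_zero {x : ℝ} (hx0 : 0 < x) (hx : x < 1) :
    halfIntegral 0 0 x = 2 * Real.log ((1 - x) ^ (1 / 2 : ℝ) + 1) - Real.log x := by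
  have key := intervalIntegral.integral_eq_sub_of_hasDerivAt_of_le (a := 0) (b := 1 - x)
    (f := fun w : ℝ => 2 * Real.log (√w + √(x + w)))
    (f' := fun w : ℝ => w ^ (((0 : ℕ) : ℝ) - 1 / 2) * (x + w) ^ (((0 : ℕ) : ℝ) - 1 / 2))
    (by linarith) ?_ ?_ (intervalIntegrable_halfIntegral 0 0 hx0 hx)
  · rw [halfIntegral, key, add_sub_cancel, add_zero, Real.sqrt_zero, zero_add, Real.sqrt_one,
      Real.log_sqrt hx0.le, Real.sqrt_eq_rpow]
    ring
  · refine ContinuousOn.mul continuousOn_const (ContinuousOn.log (by fun_prop) fun w hw => ?_)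
    have : 0 < √(x + w) := Real.sqrt_pos.2 (by linarith [hw.1])
    positivity
  · intro w hw
    have h1 : 0 < w := hw.1
    have h2 : 0 < x + w := by linarith
    have p1 := Real.sqrt_pos.2 h1
    have p2 := Real.sqrt_pos.2 h2
    have d1 : HasDerivAt (fun w : ℝ => √w) (1 / (2 * √w)) w := Real.hasDerivAt_sqrt h1.ne'
    have d2 : HasDerivAt (fun w : ℝ => √(x + w)) (1 / (2 * √(x + w))) w :=
      ((hasDerivAt_id w).const_add x).sqrt h2.ne'
    have d3 := ((d1.add d2).log (by simp only [Pi.add_apply]; positivity)).const_mul 2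
    refine d3.congr_deriv ?_
    simp only [Nat.cast_zero, zero_sub, Pi.add_apply]
    rw [Real.rpow_neg h1.le, Real.rpow_neg h2.le, ← Real.sqrt_eq_rpow, ← Real.sqrt_eq_rpow]
    field_simp
    ring

/-- Integrate the derivative of w^(a+1/2) (x+w)^(1/2) over [0, 1-x]; the boundary term at w = 0
vanishes. -/
theorem halfIntegral_succ_zero (a : ℕ) {x : ℝ} (hx0 : 0 < x) (hx : x < 1) :
    (a + 1) * halfIntegral (a + 1) 0 x =
      (1 - x) ^ ((a : ℝ) + 1 / 2) - (a + 1 / 2) * (x * halfIntegral a 0 x) := by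
  have ha : (0 : ℝ) ≤ a := by positivity
  have i1 := intervalIntegrable_halfIntegral (a + 1) 0 hx0 hx
  have i0 := intervalIntegrable_halfIntegral a 0 hx0 hx
  have key := intervalIntegral.integral_eq_sub_of_hasDerivAt_of_le (a := 0) (b := 1 - x)
    (f := fun w : ℝ => w ^ ((a : ℝ) + 1 / 2) * (x + w) ^ (1 / 2 : ℝ))
    (f' := fun w : ℝ => (a + 1) * (w ^ (((a + 1 : ℕ) : ℝ) - 1 / 2) *
      (x + w) ^ (((0 : ℕ) : ℝ) - 1 / 2)) + ((a + 1 / 2) * x) * (w ^ ((a : ℝ) - 1 / 2) *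
      (x + w) ^ (((0 : ℕ) : ℝ) - 1 / 2)))
    (by linarith) ?_ ?_ ((i1.const_mul _).add (i0.const_mul _))
  · rw [intervalIntegral.integral_add (i1.const_mul _) (i0.const_mul _),
      intervalIntegral.integral_const_mul, intervalIntegral.integral_const_mul] at key
    rw [add_sub_cancel, Real.one_rpow, mul_one, Real.zero_rpow (by positivity), zero_mul,
      sub_zero] at key
    simp only [halfIntegral]
    linarith
  · refine ContinuousOn.mul ?_ ?_
    · exact ContinuousOn.rpow_const (by fun_prop) fun w _ => Or.inr (by positivity)
    · exact ContinuousOn.rpow_const (by fun_prop) fun w _ => Or.inr (by positivity)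
  · intro w hw
    have h1 : 0 < w := hw.1
    have h2 : 0 < x + w := by linarith
    have d1 : HasDerivAt (fun w : ℝ => w ^ ((a : ℝ) + 1 / 2)) _ w :=
      Real.hasDerivAt_rpow_const (Or.inl h1.ne')
    have d2 : HasDerivAt (fun w : ℝ => (x + w) ^ (1 / 2 : ℝ)) _ w :=
      ((hasDerivAt_id w).const_add x).rpow_const (Or.inl h2.ne')
    refine (d1.mul d2).congr_deriv ?_
    have e1 : w ^ ((a : ℝ) + 1 / 2) = w * w ^ ((a : ℝ) - 1 / 2) := by
      rw [show (a : ℝ) + 1 / 2 = (a - 1 / 2) + 1 by ring, Real.rpow_add_one h1.ne']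
      ring
    have e2 : (x + w) ^ (1 / 2 : ℝ) = (x + w) * (x + w) ^ (-(1 / 2) : ℝ) := by
      rw [show (1 / 2 : ℝ) = -(1 / 2) + 1 by norm_num, Real.rpow_add_one h2.ne']
      ring_nf
    rw [show (a : ℝ) + 1 / 2 - 1 = a - 1 / 2 by ring, show (1 / 2 : ℝ) - 1 = -(1 / 2) by norm_num,
      show ((a + 1 : ℕ) : ℝ) - 1 / 2 = a + 1 / 2 by push_cast; ring, Nat.cast_zero, zero_sub, id,
      e1, e2]
    ring

/-- Split one factor x + w off the second power. -/
theorem halfIntegral_succ (a b : ℕ) {x : ℝ} (hx0 : 0 < x) (hx : x < 1) :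
    halfIntegral a (b + 1) x = x * halfIntegral a b x + halfIntegral (a + 1) b x := by
  have i1 := intervalIntegrable_halfIntegral (a + 1) b hx0 hx
  have i0 := intervalIntegrable_halfIntegral a b hx0 hx
  simp only [halfIntegral]
  rw [← intervalIntegral.integral_const_mul, ← intervalIntegral.integral_add (i0.const_mul _) i1]
  refine intervalIntegral.integral_congr_ae (ae_of_all _ fun w hw => ?_)
  rw [Set.uIoc_of_le (by linarith)] at hw
  have h1 : 0 < w := hw.1
  have h2 : 0 < x + w := by linarith
  rw [show ((b + 1 : ℕ) : ℝ) - 1 / 2 = (b - 1 / 2) + 1 by push_cast; ring,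
    show ((a + 1 : ℕ) : ℝ) - 1 / 2 = (a - 1 / 2) + 1 by push_cast; ring,
    Real.rpow_add_one h1.ne', Real.rpow_add_one h2.ne']
  ring

/-- The expansion of `halfIntegral` at `x = 0` has a single logarithmic term. -/
theorem exists_halfIntegral_expansion (a b : ℕ) : ∃ A : ℝ → ℝ, AnalyticAt ℝ A 0 ∧
    ∀ x : ℝ, 0 < x → x < 1 →
      halfIntegral a b x = A x + logCoeff a b * x ^ (a + b) * Real.log x := by
  -- Lowering b raises a in one term, so a stays general. At b = 0 integration by parts lowers a to
  -- the explicit base case.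
  induction b generalizing a with
  | zero =>
    induction a with
    | zero =>
      refine ⟨fun x => 2 * Real.log ((1 - x) ^ (1 / 2 : ℝ) + 1), ?_, fun x hx0 hx => ?_⟩
      · refine analyticAt_const.mul (((analyticAt_one_sub_rpow _).add analyticAt_const).log ?_)
        norm_num
      · rw [halfIntegral_zero_zero hx0 hx, logCoeff_zero_zero]
        ring
    | succ a ih =>
      obtain ⟨A, hA, hAx⟩ := ih
      refine ⟨fun x => ((1 - x) ^ ((a : ℝ) + 1 / 2) - (a + 1 / 2) * (x * A x)) * (a + 1 : ℝ)⁻¹,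
        ((analyticAt_one_sub_rpow _).sub (analyticAt_const.mul (analyticAt_id.mul hA))).mul
          analyticAt_const, fun x hx0 hx => ?_⟩
      have h := halfIntegral_succ_zero a hx0 hx
      have h' := logCoeff_succ_zero a
      have ha : (a + 1 : ℝ) ≠ 0 := by positivity
      rw [hAx x hx0 hx] at h
      rw [← mul_right_inj' ha, h]
      field_simp
      linear_combination (-2 * (x * x ^ a * Real.log x)) * h'
  | succ b ih =>
    obtain ⟨A, hA, hAx⟩ := ih a
    obtain ⟨B, hB, hBx⟩ := ih (a + 1)
    refine ⟨fun x => x * A x + B x, (analyticAt_id.mul hA).add hB, fun x hx0 hx => ?_⟩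
    rw [halfIntegral_succ a b hx0 hx, hAx x hx0 hx, hBx x hx0 hx, logCoeff_succ]
    ring

theorem tendsto_pow_mul_log {N : ℕ} (hN : 0 < N) :
    Tendsto (fun x : ℝ => x ^ N * Real.log x) (𝓝[>] 0) (𝓝 0) := by
  have hc : Continuous fun x : ℝ => x ^ (N - 1) * (x * Real.log x) :=
    (continuous_pow _).mul Real.continuous_mul_log
  have := (hc.tendsto 0).mono_left (nhdsWithin_le_nhds (s := Set.Ioi 0))
  simp only [zero_mul, mul_zero] at this
  refine this.congr fun x => ?_
  rw [← mul_assoc, ← pow_succ, Nat.sub_add_cancel hN]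

/-! ### Odd dimension: expansion of the weight -/

section OddDimension

variable {m k : ℕ}

/-- Reflect w to 1 - x - w and expand (1-x-w)^(m-1) by the binomial theorem. -/
theorem rpow_mul_eulerIntegral_eq_sum (hm : 0 < m) {h x : ℝ} (hk : h = k + 1 / 2)
    (hx0 : 0 < x) (hx : x < 1) :
    (1 - x) ^ ((m : ℝ) + h - 1) * eulerIntegral m h (1 - x) =
      ∑ j ∈ Finset.range m, (-1) ^ j * (1 - x) ^ (m - 1 - j) * (m - 1).choose j *
        halfIntegral (j + k) k x := by
  have h1 := intervalIntegral.integral_comp_sub_left (a := 0) (b := 1 - x)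
    (fun w : ℝ => w ^ (m - 1) * (1 - x - w) ^ (h - 1) * (1 - w) ^ (h - 1)) (1 - x)
  rw [sub_self, sub_zero] at h1
  rw [rpow_mul_eulerIntegral m hm (by linarith), ← h1]
  simp only [halfIntegral]
  simp_rw [← intervalIntegral.integral_const_mul]
  rw [← intervalIntegral.integral_finsetSum fun j _ =>
    (intervalIntegrable_halfIntegral (j + k) k hx0 hx).const_mul _]
  refine intervalIntegral.integral_congr_ae (ae_of_all _ fun w hw => ?_)
  rw [Set.uIoc_of_le (by linarith)] at hw
  have hw0 : 0 < w := hw.1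
  rw [sub_sub_cancel, show 1 - (1 - x - w) = x + w by ring, sub_eq_neg_add (1 - x), add_pow,
    Nat.sub_add_cancel hm, Finset.sum_mul, Finset.sum_mul]
  refine Finset.sum_congr rfl fun j _ => ?_
  rw [show ((j + k : ℕ) : ℝ) - 1 / 2 = (h - 1) + j by rw [hk]; push_cast; ring,
    show (k : ℝ) - 1 / 2 = h - 1 by rw [hk]; ring, Real.rpow_add_natCast hw0.ne', neg_pow w]
  ring

/-- In half-integer dimension the normalised Euler integral has one logarithmic term at `x = 0`. -/
theorem exists_eulerIntegral_expansion (hm : 0 < m) {h : ℝ} (hk : h = k + 1 / 2) :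
    ∃ A B : ℝ → ℝ, AnalyticAt ℝ A 0 ∧ AnalyticAt ℝ B 0 ∧ B 0 = logCoeff k k ∧
      ∀ x : ℝ, 0 < x → x < 1 →
        (1 - x) ^ ((m : ℝ) + h - 1) * eulerIntegral m h (1 - x) =
          A x + x ^ (2 * k) * (B x * Real.log x) := by
  choose A hA hAx using fun j : ℕ => exists_halfIntegral_expansion (j + k) k
  refine ⟨fun x => ∑ j ∈ Finset.range m, (-1) ^ j * (1 - x) ^ (m - 1 - j) * (m - 1).choose j * A j x,
    fun x => ∑ j ∈ Finset.range m, (-1) ^ j * (1 - x) ^ (m - 1 - j) * (m - 1).choose j *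
      (logCoeff (j + k) k * x ^ j), ?_, ?_, ?_, fun x hx0 hx => ?_⟩
  · refine Finset.analyticAt_fun_sum _ fun j _ => AnalyticAt.mul ?_ (hA j)
    fun_prop
  · exact Finset.analyticAt_fun_sum _ fun j _ => by fun_prop
  · beta_reduce
    -- The logarithm of the j-th summand carries x^(j+2k), so only j = 0 counts at x = 0.
    rw [Finset.sum_eq_single_of_mem 0 (Finset.mem_range.2 hm) fun j _ hj => by simp [hj]]
    simp
  · rw [rpow_mul_eulerIntegral_eq_sum hm hk hx0 hx, Finset.sum_mul, Finset.mul_sum,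
      ← Finset.sum_add_distrib]
    refine Finset.sum_congr rfl fun j _ => ?_
    rw [hAx j x hx0 hx]
    ring

/-- In odd dimension the weight has a logarithmic expansion at `x = 0`. -/
theorem exists_radialWeight_expansion (hm : 0 < m) (hk : 0 < k) :
    ∃ A₀ A₁ A₂ : ℝ → ℝ, AnalyticAt ℝ A₀ 0 ∧ AnalyticAt ℝ A₁ 0 ∧ AnalyticAt ℝ A₂ 0 ∧
      A₁ 0 = 2 * residueConst (2 * k + 1) m * logCoeff k k ∧
      ∀ x : ℝ, 0 < x → x < 1 → radialWeight (2 * k + 1) m x = A₀ x +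
        x ^ (2 * k) * (Real.log x * A₁ x) +
        x ^ (2 * (2 * k)) * (Real.log x * (Real.log x * A₂ x)) := by
  set h : ℝ := ((2 * k + 1 : ℕ) : ℝ) / 2 with hh
  have hhk : h = k + 1 / 2 := by
    rw [hh]
    push_cast
    ring
  have hk1 : (1 : ℝ) ≤ k := by exact_mod_cast hk
  obtain ⟨A, B, hA, hB, hB0, hAB⟩ := exists_eulerIntegral_expansion hm hhk
  set K := residueConst (2 * k + 1) m
  set q : ℝ := (m : ℝ) + h - 1 with hq
  have hq0 : 0 < q := by
    have : (0 : ℝ) ≤ m := by positivity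
    rw [hq, hhk]
    linarith
  -- Let x → 0+ in the expansion: x^(2k) log x tends to 0 because k > 0, so A(0) = J(1).
  have hA0 : K * A 0 = 1 := by
    have hJ : K * eulerIntegral m h 1 = 1 :=
      residueConst_mul_eulerIntegral_one (n := 2 * k + 1) (by omega) hm
    have c1 : Continuous fun x : ℝ => (1 - x) ^ q * eulerIntegral m h (1 - x) :=
      ((by fun_prop : Continuous fun x : ℝ => 1 - x).rpow_const fun _ => Or.inr hq0.le).mul
        ((continuous_eulerIntegral m (by linarith)).comp (by fun_prop))
    have t1 := (c1.tendsto 0).mono_left (nhdsWithin_le_nhds (s := Set.Ioi 0))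
    rw [sub_zero, Real.one_rpow, one_mul] at t1
    have t2 := (hA.continuousAt.tendsto.mono_left (nhdsWithin_le_nhds (s := Set.Ioi 0))).add
      ((hB.continuousAt.tendsto.mono_left (nhdsWithin_le_nhds (s := Set.Ioi 0))).mul
        (tendsto_pow_mul_log (N := 2 * k) (by omega)))
    rw [mul_zero, add_zero] at t2
    have t3 := t2.congr' (f₂ := fun x : ℝ => (1 - x) ^ q * eulerIntegral m h (1 - x)) (by
      filter_upwards [Ioo_mem_nhdsGT (show (0 : ℝ) < 1 by norm_num)] with x hx
      rw [hAB x hx.1 hx.2]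
      ring)
    rw [tendsto_nhds_unique t3 t1, hJ]
  -- Squaring (1-x)^q J(1-x) yields (1-x)^(2q) where the weight has (1-x)^q, hence the correcting
  -- factor (1-x)^(-q), equal to 1 at x = 0.
  have hw := (analyticAt_const (v := K ^ 2)).mul (analyticAt_one_sub_rpow (-q))
  refine ⟨fun x => K ^ 2 * (1 - x) ^ (-q) * (A x * A x),
    fun x => K ^ 2 * (1 - x) ^ (-q) * (2 * (A x * B x)),
    fun x => K ^ 2 * (1 - x) ^ (-q) * (B x * B x), hw.mul (hA.mul hA),
    hw.mul (analyticAt_const.mul (hA.mul hB)), hw.mul (hB.mul hB), ?_, fun x hx0 hx => ?_⟩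
  · beta_reduce
    rw [hB0, sub_zero, Real.one_rpow]
    linear_combination (2 * K * logCoeff k k) * hA0
  · have e := hAB x hx0 hx
    have hx1 : 0 < 1 - x := by linarith
    have hne := (Real.rpow_pos_of_pos hx1 q).ne'
    have e2 : radialWeight (2 * k + 1) m x = K ^ 2 * (1 - x) ^ (-q) *
        ((1 - x) ^ q * eulerIntegral m h (1 - x)) ^ 2 := by
      rw [radialWeight, Real.rpow_neg hx1.le]
      change (1 - x) ^ q * (K * eulerIntegral m h (1 - x)) ^ 2 = _
      field_simp
    rw [e2, e]
    ring

end OddDimension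

theorem AnalyticAt.ofReal_comp {A : ℝ → ℝ} {x : ℝ} (hA : AnalyticAt ℝ A x) :
    AnalyticAt ℝ (fun x => (A x : ℂ)) x :=
  (Complex.ofRealCLM.analyticAt _).comp hA

theorem exists_continuation_odd {n m : ℕ} (hn : 2 < n) (hm : 0 < m) (ho : Odd n) :
    ∃ F : ℂ → ℂ, Meromorphic F ∧ (∀ s : ℂ, -1 < s.re → F s = coeffI n m s) ∧
      HasSimplePoleWithResidue F (-(n : ℂ)) (2 * (residueConst n m : ℂ)) := by
  have ho' := ho
  obtain ⟨k, rfl⟩ := ho'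
  have hk : 0 < k := by omega
  obtain ⟨A₀, A₁, A₂, h₀, h₁, h₂, hA₁, hA⟩ := exists_radialWeight_expansion hm hk
  obtain ⟨M, hM, hMe, hMt⟩ := exists_mellin_continuation (g := cutRadialWeight (2 * k + 1) m)
    (R := 1) (N := 2 * k) (by omega) (locallyIntegrableOn_cutRadialWeight hn)
    (fun x hx => Set.indicator_of_notMem (fun h => absurd h.2 (not_le.2 hx)) _)
    h₀.ofReal_comp h₁.ofReal_comp h₂.ofReal_comp (by
      filter_upwards [Ioo_mem_nhdsGT (show (0 : ℝ) < 1 by norm_num)] with x hx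
      have hx' : x ∈ Set.Ioc (0 : ℝ) 1 := ⟨hx.1, hx.2.le⟩
      rw [cutRadialWeight, Set.indicator_of_mem hx', hA x hx.1 hx.2]
      push_cast
      rfl)
  have hF : Meromorphic fun s => gammaFactor (2 * k + 1) s * M (s + 1) :=
    (meromorphic_gammaFactor _).mul
      (Meromorphic.meromorphic_fun_comp_add_const_iff_meromorphic.2 hM)
  refine ⟨_, hF, fun s hs => ?_, ?_⟩
  · rw [coeffI_eq hn hm, hMe (s + 1) (by simpa using by linarith)]
  · refine hasSimplePoleWithResidue_of_tendsto (hF _)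
      (by exact_mod_cast (mul_pos two_pos (residueConst_pos hn hm)).ne') ?_
    have t₂ := tendsto_add_const_nhdsNE 1 (-((2 * k + 1 : ℕ) : ℂ))
    have e : -((2 * k + 1 : ℕ) : ℂ) + 1 = -((2 * k : ℕ) : ℂ) := by
      push_cast
      ring
    rw [e] at t₂
    have t := (tendsto_gammaFactor_odd ho).mul (hMt.comp t₂)
    -- The Gamma values at k + 1/2 and 1/2 - k and the factorial (2k)! all cancel against `logCoeff
    -- k k`; its minus sign meets that of the double pole.
    have hval : Complex.Gamma (1 - ((2 * k + 1 : ℕ) : ℂ) / 2) /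
        Complex.Gamma (((2 * k + 1 : ℕ) : ℂ) / 2) * ((2 * k + 1 - 1).factorial : ℂ) *
          -(A₁ 0 : ℂ) = 2 * (residueConst (2 * k + 1) m : ℂ) := by
      have g1 : Complex.Gamma (1 - ((2 * k + 1 : ℕ) : ℂ) / 2) =
          (Real.Gamma (1 / 2 - k) : ℂ) := by
        rw [← Complex.Gamma_ofReal]
        congr 1
        push_cast
        ring
      have g2 : Complex.Gamma (((2 * k + 1 : ℕ) : ℂ) / 2) = (Real.Gamma (k + 1 / 2) : ℂ) := by
        rw [← Complex.Gamma_ofReal]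
        congr 1
        push_cast
        ring
      have n1 := Gamma_half_sub_ne_zero k
      have n2 : Real.Gamma (k + 1 / 2) ≠ 0 := (Real.Gamma_pos_of_pos (by positivity)).ne'
      have n3 : ((2 * k).factorial : ℝ) ≠ 0 := by exact_mod_cast Nat.factorial_ne_zero _
      rw [g1, g2, hA₁, logCoeff, Nat.add_sub_cancel, ← two_mul]
      norm_cast
      generalize Real.Gamma (1 / 2 - k) = g at n1 ⊢
      field_simp
    rw [hval] at t
    refine t.congr' ?_
    filter_upwards [self_mem_nhdsWithin] with s hs
    have hs' : s + ((2 * k + 1 : ℕ) : ℂ) ≠ 0 := fun h => hs (eq_neg_of_add_eq_zero_left h)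
    rw [Function.comp_apply, show s + 1 + ((2 * k : ℕ) : ℂ) = s + ((2 * k + 1 : ℕ) : ℂ) by
      push_cast; ring, sub_neg_eq_add]
    field_simp

/-! ### The theorem, by parity of n -/

theorem mainTheorem4 (n m : ℕ) (hn : 2 < n) (hm : 0 < m) :
    (∀ s : ℂ, -1 < s.re →
      IntervalIntegrable (coeffIntegrand n m s) volume (0 : ℝ) 1) ∧
    ∃ F : ℂ → ℂ, Meromorphic F ∧
      (∀ s : ℂ, -1 < s.re → F s = coeffI n m s) ∧
      (Even n → HasSimplePoleWithResidue F (-(n : ℂ))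
        ((ascPochhammer ℂ m).eval ((n : ℂ) - 1) / Complex.Gamma (m : ℂ))) ∧
      (Odd n → HasSimplePoleWithResidue F (-(n : ℂ))
        (2 * (ascPochhammer ℂ m).eval ((n : ℂ) - 1) / Complex.Gamma (m : ℂ))) := by
  refine ⟨fun s hs => intervalIntegrable_coeffIntegrand hn hm hs, ?_⟩
  rw [mul_div_assoc, ← ofReal_residueConst]
  rcases Nat.even_or_odd n with he | ho
  · obtain ⟨F, hF, hFe, hFp⟩ := exists_continuation_even hn hm he
    exact ⟨F, hF, hFe, fun _ => hFp, fun ho => absurd he (Nat.not_even_iff_odd.2 ho)⟩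
  · obtain ⟨F, hF, hFe, hFp⟩ := exists_continuation_odd hn hm ho
    exact ⟨F, hF, hFe, fun he => absurd he (Nat.not_even_iff_odd.2 ho), fun _ => hFp⟩
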